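/- **Setting.** Let $f_0,f_1,\dots,f_m:\mathbb R^n\to\mathbb R$, $I=\{1,\dots,m\}$, $g_j=\nabla f_j$, and consider the problem $\min f_0(x)$ subject to $f_j(x)\le 0$, $j\in I$, with feasible set $X=\{x: f_j(x)\le0,\ j\in I\}$. Put $\varphi(x)=\max\{0,f_j(x)\ (j\in I)\}$, and $\bar f_j(x)=f_j(x)$ if $f_j(x)\le 0$, $\bar f_j(x)=f_j(x)-\varphi(x)$ if $f_j(x)>0$. A KKT pair is a pair $(x,\lambda)$ with $g_0(x)+\sum_{j\in I}\lambda_jg_j(x)=0$ and $f_j(x)\le0$, $\lambda_j\ge0$, $\lambda_jf_j(x)=0$ for all $j\in I$. Let $L(x,\lambda)=f_0(x)+\sum_{j\in I}\lambda_jf_j(x)$, and let $\|\cdot\|$ be the Euclidean norm. **Algorithm.** Parameters: $\gamma,\eta,\varepsilon\in(0,1)$, $0<\theta<\sigma<1$, $0<\varrho<\sigma$, $\xi,\zeta>0$, $\alpha\in(0,\frac12)$, $\rho>1$, $\delta>2$, $\tau\in(2,3)$. The starting point $x^0\in\mathbb R^n$ is arbitrary, and $B_0,B_1,\dots$ are arbitrary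 symmetric positive definite matrices. Write $\varphi_k=\varphi(x^k)$. Iteration $k$: 1. Let $d_0^k$ be the solution of the quadratic program $\min_d\ g_0(x^k)^Td+\frac12d^TB_kd$ s.t. $\bar f_j(x^k)+g_j(x^k)^Td\le0$ $(j\in I)$, with KKT multipliers $\lambda^k$. If $(d_0^k,\varphi_k)=(0,0)$, stop. 2. Let $D_j^k=|\bar f_j(x^k)|\,\bigl(|\bar f_j(x^k)+g_j(x^k)^Td_0^k|+\|d_0^k\|\bigr)$. For $r\in\mathbb R^m$ let $S_k(r)$ be the linear system $B_kd+\sum_{j\in I}h_jg_j(x^k)=0$, $g_j(x^k)^Td-D_j^kh_j=r_j$ $(j\in I)$ in the unknowns $(d,h)\in\mathbb R^n\times\mathbb R^m$. Let $(d_1^k,h_1^k)$ solve $S_k(r)$ with $r_j=-(\|d_0^k\|^\tau+\varphi_k^\sigma)-\bigl(f_j(x^k+d_0^k)-f_j(x^k)-g_j(x^k)^Td_0^k\bigr)$, and let $d^k=d_0^k+d_1^k$. If $g_0(x^k)^Td_0^k\le\zeta\min\{-\|d_0^k\|^\delta,-\|d^k\|^\delta\}+\xi\varphi_k^\varrho$,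 go to 3, otherwise go to 4. 3. Let $t_k$ be the first $t\in\{1,\frac12,\frac14,\dots\}$ with $t\ge\varepsilon$ for which $f_0(x^k+td^k)\le f_0(x^k)+\alpha tg_0(x^k)^Td_0^k+\rho(1-\alpha)t\varphi_k^\theta$; $f_j(x^k+td^k)\le\varphi_k-\alpha t(\|d_0^k\|^\tau+\varphi_k^\sigma)$ for all $j\in I$ with $f_j(x^k)>0$; and $f_j(x^k+td^k)\le0$ for all $j\in I$ with $f_j(x^k)\le0$. If there is one, go to 6, otherwise go to 4. 4. Let $(\tilde d^k,\tilde h^k)$ solve $S_k(r)$ with $r_j=-(\|d_0^k\|+\varphi_k^\sigma)$ for all $j$, let $$\beta_k=\min\Bigl\{1,\ \frac{(\theta-1)g_0(x^k)^Td_0^k+\varphi_k^\theta}{g_0(x^k)^T\tilde d^k-g_0(x^k)^Td_0^k}\Bigr\}\ \text{ if } g_0(x^k)^T\tilde d^k>g_0(x^k)^Td_0^k,\qquad \beta_k=1\ \text{ otherwise},$$ and $q^k=(1-\beta_k)d_0^k+\beta_k\tilde d^k$. 5. Let $t_k$ be the first $t\in\{1,\eta,\eta^2,\dots\}$ for which $f_0(x^k+tq^k)\le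 f_0(x^k)+\gamma tg_0(x^k)^Tq^k+\rho(1-\gamma)t\varphi_k^\theta$; $f_j(x^k+tq^k)\le\varphi_k-\gamma t\beta_k(\|d_0^k\|+\varphi_k^\sigma)$ for all $j\in I$ with $f_j(x^k)>0$; and $f_j(x^k+tq^k)\le0$ for all $j\in I$ with $f_j(x^k)\le0$. Reset $d^k=q^k$. 6. Set $x^{k+1}=x^k+t_kd^k$. **Theorem.** Let $\{x^k\}$ be an infinite sequence of iterates generated by this algorithm, and suppose: - (a) for every $x\in\mathbb R^n$ the gradients $g_j(x)$, $j\in I$ with $\bar f_j(x)=0$, are linearly independent; - (b) there are $a,b>0$ with $a\|d\|^2\le d^TB_kd\le b\|d\|^2$ for all $d\in\mathbb R^n$ and all $k$; - (c) $f_0,f_1,\dots,f_m$ are twice continuously differentiable, and $\{x^k\}$ is bounded and has an accumulation point $x^*$ such that the KKT pair $(x^*,\lambda^*)$ satisfies the strong second-order sufficient condition: $d^T\nabla^2_{xx}L(x^*,\lambda^*)d>0$ for all $d\ne0$ with $g_j(x^*)^Td=0$ for every $j\in I$ with $\lambda_j^*>0$; - (d) $\|(\nabla^2_{xx}L(x^*,\lambda^*)-B_k)d_0^k\|=o(\|d_0^k\|)$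 as $k\to\infty$. (That $x^*$ is a KKT point is not assumed: (c) and (d) are required of every $\lambda^*$ for which $(x^*,\lambda^*)$ is a KKT pair.) Then $\varphi(x^{k+1})=0$, i.e. $x^{k+1}\in X$, for all sufficiently large $k$. -/

import Mathlib

namespace SubfeasibleSQP

/-- The space `ℝⁿ` with its Euclidean norm. -/
abbrev E (n : ℕ) : Type := EuclideanSpace ℝ (Fin n)

/-- The data of the problem `min f₀ x` subject to `f j x ≤ 0`, `j = 1, …, m`. -/
structure NCP (n m : ℕ) where
  f₀ : E n → ℝ
  f : Fin m → E n → ℝ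

/-- The product `B d` of a matrix and a vector of `ℝⁿ`. -/
noncomputable def act {n : ℕ} (B : Matrix (Fin n) (Fin n) ℝ) (d : E n) : E n :=
  WithLp.toLp 2 (B.mulVec d.ofLp)

namespace NCP

variable {n m : ℕ} (P : NCP n m)

/-- The feasible set `X`. -/
def feasible : Set (E n) := {x | ∀ j, P.f j x ≤ 0}

/-- The gradient of the objective. -/
noncomputable def g₀ (x : E n) : E n := gradient P.f₀ x

/-- The gradients of the constraint functions. -/
noncomputable def g (j : Fin m) (x : E n) : E n := gradient (P.f j) x

/-- The constraint violation `φ(x) = max {0, f j x : j}`. -/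
noncomputable def viol (x : E n) : ℝ := Finset.univ.fold max 0 (fun j => P.f j x)

/-- The shifted constraint values: `f j x` if `f j x ≤ 0`, and `f j x - φ(x)` if `f j x > 0`. -/
noncomputable def fbar (j : Fin m) (x : E n) : ℝ :=
  if P.f j x ≤ 0 then P.f j x else P.f j x - P.viol x

/-- The gradients `g j x` with `fbar j x = 0` form a linearly independent family, at every `x`. -/
def GradIndep : Prop :=
  ∀ x, LinearIndependent ℝ (fun j : {j : Fin m // P.fbar j x = 0} => P.g j x)

/-- All functions of the problem are twice continuously differentiable. -/
def IsC2 : Prop := ContDiff ℝ 2 P.f₀ ∧ ∀ j, ContDiff ℝ 2 (P.f j)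

/-- The Lagrangian `L(x, lam)`. -/
noncomputable def lagrangian (lam : Fin m → ℝ) (x : E n) : ℝ :=
  P.f₀ x + ∑ j, lam j * P.f j x

/-- The product `∇²ₓₓ L(x, lam) d` of the Hessian of the Lagrangian and a vector. -/
noncomputable def hessL (lam : Fin m → ℝ) (x d : E n) : E n :=
  fderiv ℝ (gradient (P.lagrangian lam)) x d

/-- `(x, lam)` is a KKT pair of the problem. -/
structure IsKKTPair (x : E n) (lam : Fin m → ℝ) : Prop where
  stationary : P.g₀ x + ∑ j, lam j • P.g j x = 0
  primal : ∀ j, P.f j x ≤ 0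
  dual : ∀ j, 0 ≤ lam j
  compl : ∀ j, lam j * P.f j x = 0

/-- The strong second-order sufficient condition at `(x, lam)`. -/
def SSOSC (x : E n) (lam : Fin m → ℝ) : Prop :=
  ∀ d : E n, d ≠ 0 → (∀ j, 0 < lam j → inner ℝ (P.g j x) d = 0) →
    0 < inner ℝ d (P.hessL lam x d)

/-- `d` is feasible for the quadratic subproblem at `x`. -/
def QPFeasible (x d : E n) : Prop := ∀ j, P.fbar j x + inner ℝ (P.g j x) d ≤ 0

/-- The objective of the quadratic subproblem. -/
noncomputable def qpObj (x : E n) (B : Matrix (Fin n) (Fin n) ℝ) (d : E n) : ℝ :=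
  inner ℝ (P.g₀ x) d + 1 / 2 * inner ℝ d (act B d)

/-- `d` is an optimal solution of the quadratic subproblem and `lam` a corresponding vector of
KKT multipliers. -/
structure QPSolution (x : E n) (B : Matrix (Fin n) (Fin n) ℝ) (d : E n) (lam : Fin m → ℝ) :
    Prop where
  feasible : P.QPFeasible x d
  optimal : ∀ d', P.QPFeasible x d' → P.qpObj x B d ≤ P.qpObj x B d'
  stationary : P.g₀ x + act B d + ∑ j, lam j • P.g j x = 0
  dual : ∀ j, 0 ≤ lam j
  compl : ∀ j, lam j * (P.fbar j x + inner ℝ (P.g j x) d) = 0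

/-- The diagonal entries `D j` of the lower right block of the linear systems. -/
noncomputable def diag (x d₀ : E n) (j : Fin m) : ℝ :=
  |P.fbar j x| * (|P.fbar j x + inner ℝ (P.g j x) d₀| + ‖d₀‖)

/-- `(d, h)` solves the block linear system `B d + N h = 0`, `Nᵀ d - D h = r`, where the columns
of `N` are the gradients `g j x` and `D` is the diagonal matrix with entries `diag x d₀ j`. -/
def SolvesSLE (x : E n) (B : Matrix (Fin n) (Fin n) ℝ) (d₀ : E n) (r : Fin m → ℝ)
    (d : E n) (h : Fin m → ℝ) : Prop :=
  act B d + ∑ j, h j • P.g j x = 0 ∧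
    ∀ j, inner ℝ (P.g j x) d - P.diag x d₀ j * h j = r j

end NCP

/-- The parameters of the algorithm. -/
structure Params where
  (γ η ε θ σ ϱ ξ ζ α ρ δ τ : ℝ)
  γ_mem : 0 < γ ∧ γ < 1
  η_mem : 0 < η ∧ η < 1
  ε_mem : 0 < ε ∧ ε < 1
  θ_pos : 0 < θ
  θ_lt : θ < σ
  σ_lt : σ < 1
  ϱ_pos : 0 < ϱ
  ϱ_lt : ϱ < σ
  ξ_pos : 0 < ξ
  ζ_pos : 0 < ζ
  α_mem : 0 < α ∧ α < 1 / 2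
  ρ_gt : 1 < ρ
  δ_gt : 2 < δ
  τ_mem : 2 < τ ∧ τ < 3

namespace Params

variable (p : Params) {n m : ℕ} (P : NCP n m)

/-- Right-hand side of the system for `d̃`. -/
noncomputable def rhsTilde (x d₀ : E n) (_ : Fin m) : ℝ :=
  -(‖d₀‖ + P.viol x ^ p.σ)

/-- Right-hand side of the system for the higher-order correction `d₁`. -/
noncomputable def rhsCorr (x d₀ : E n) (j : Fin m) : ℝ :=
  -(‖d₀‖ ^ p.τ + P.viol x ^ p.σ) - (P.f j (x + d₀) - P.f j x - inner ℝ (P.g j x) d₀)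

/-- The weight `β` of the convex combination of `d₀` and `d̃`. -/
noncomputable def beta (x d₀ dt : E n) : ℝ :=
  if inner ℝ (P.g₀ x) d₀ < inner ℝ (P.g₀ x) dt then
    min 1 (((p.θ - 1) * inner ℝ (P.g₀ x) d₀ + P.viol x ^ p.θ) /
      (inner ℝ (P.g₀ x) dt - inner ℝ (P.g₀ x) d₀))
  else 1

/-- The direction `q = (1 - β) d₀ + β d̃`. -/
noncomputable def qdir (x d₀ dt : E n) : E n :=
  (1 - p.beta P x d₀ dt) • d₀ + p.beta P x d₀ dt • dt

/-- The test on the direction `d = d₀ + d₁` that precedes the first line search. -/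
def DirTest (x d₀ d : E n) : Prop :=
  inner ℝ (P.g₀ x) d₀ ≤
    p.ζ * min (-‖d₀‖ ^ p.δ) (-‖d‖ ^ p.δ) + p.ξ * P.viol x ^ p.ϱ

/-- The inequalities of the first line search (along `d = d₀ + d₁`) for the trial step `t`. -/
structure Search₁ (x d₀ d : E n) (t : ℝ) : Prop where
  obj : P.f₀ (x + t • d) ≤
    P.f₀ x + p.α * t * inner ℝ (P.g₀ x) d₀ + p.ρ * (1 - p.α) * t * P.viol x ^ p.θ
  violated : ∀ j, 0 < P.f j x →
    P.f j (x + t • d) ≤ P.viol x - p.α * t * (‖d₀‖ ^ p.τ + P.viol x ^ p.σ)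
  satisfied : ∀ j, P.f j x ≤ 0 → P.f j (x + t • d) ≤ 0

/-- The inequalities of the second line search (along `q`, with weight `β`) for the trial
step `t`. -/
structure Search₂ (x d₀ q : E n) (β t : ℝ) : Prop where
  obj : P.f₀ (x + t • q) ≤
    P.f₀ x + p.γ * t * inner ℝ (P.g₀ x) q + p.ρ * (1 - p.γ) * t * P.viol x ^ p.θ
  violated : ∀ j, 0 < P.f j x →
    P.f j (x + t • q) ≤ P.viol x - p.γ * t * β * (‖d₀‖ + P.viol x ^ p.σ)
  satisfied : ∀ j, P.f j x ≤ 0 → P.f j (x + t • q) ≤ 0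

/-- The first line search along `d` succeeds with step `t`: `t` is the first of the trial steps
`1, 1/2, 1/4, …` not below `ε` that passes. -/
def Accept₁ (x d₀ d : E n) (t : ℝ) : Prop :=
  ∃ i : ℕ, t = (1 / 2) ^ i ∧ p.ε ≤ t ∧ p.Search₁ P x d₀ d t ∧
    ∀ l < i, ¬ p.Search₁ P x d₀ d ((1 / 2) ^ l)

/-- The second line search returns `t`: the first of `1, η, η², …` that passes. -/
def Accept₂ (x d₀ q : E n) (β t : ℝ) : Prop :=
  ∃ i : ℕ, t = p.η ^ i ∧ p.Search₂ P x d₀ q β t ∧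
    ∀ l < i, ¬ p.Search₂ P x d₀ q β (p.η ^ l)

/-- One iteration (after `d₀` was computed), leading from `x` to `x'`. The correction `d₁` is
computed; if `d₀ + d₁` passes the direction test and the first line search succeeds, the step is
taken along `d₀ + d₁`; otherwise it is taken along `q` with the second line search. -/
def Step (x : E n) (B : Matrix (Fin n) (Fin n) ℝ) (d₀ x' : E n) : Prop :=
  ∃ (d₁ : E n) (h₁ : Fin m → ℝ), P.SolvesSLE x B d₀ (p.rhsCorr P x d₀) d₁ h₁ ∧
    ((p.DirTest P x d₀ (d₀ + d₁) ∧
        ∃ t, p.Accept₁ P x d₀ (d₀ + d₁) t ∧ x' = x + t • (d₀ + d₁)) ∨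
      (¬ (p.DirTest P x d₀ (d₀ + d₁) ∧ ∃ t, p.Accept₁ P x d₀ (d₀ + d₁) t) ∧
        ∃ (dt : E n) (ht : Fin m → ℝ), P.SolvesSLE x B d₀ (p.rhsTilde P x d₀) dt ht ∧
          ∃ t, p.Accept₂ P x d₀ (p.qdir P x d₀ dt) (p.beta P x d₀ dt) t ∧
            x' = x + t • p.qdir P x d₀ dt))

/-- `x`, `B`, `d₀`, `lam` are the iterates, matrices, subproblem solutions and multipliers of a
run of the algorithm that never stops. The starting point is arbitrary, and the matrices are any
symmetric positive definite matrices. -/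
structure IsRun (x : ℕ → E n) (B : ℕ → Matrix (Fin n) (Fin n) ℝ) (d₀ : ℕ → E n)
    (lam : ℕ → Fin m → ℝ) : Prop where
  posDef : ∀ k, (B k).PosDef
  qp : ∀ k, P.QPSolution (x k) (B k) (d₀ k) (lam k)
  not_stop : ∀ k, ¬ (d₀ k = 0 ∧ P.viol (x k) = 0)
  step : ∀ k, p.Step P (x k) (B k) (d₀ k) (x (k + 1))

end Params

/-- The matrices `B k` are uniformly positive definite and bounded. -/
def UniformlyPosDef {n : ℕ} (B : ℕ → Matrix (Fin n) (Fin n) ℝ) : Prop :=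
  ∃ a b : ℝ, 0 < a ∧ 0 < b ∧ ∀ (k : ℕ) (d : E n),
    a * ‖d‖ ^ 2 ≤ inner ℝ d (act (B k) d) ∧ inner ℝ d (act (B k) d) ≤ b * ‖d‖ ^ 2

end SubfeasibleSQP

/-! Both line searches keep satisfied constraints satisfied, so feasibility persists once reached
(`Step.viol_eq_zero`). It remains to find one feasible iterate, which `IsRun.exists_viol_eq_zero`
does by contradiction.

Suppose φ(x^k) > 0 for all k. Every accepted step then lowers φ, so φ(x^k) converges and its
decrements tend to 0. Fix an ultrafilter U finer than `atTop` along which x^k → x*; it decides which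
line search is the relevant one.

If it is the first, each decrement is at least αε φ_k^σ. Hence φ(x*) = 0, and since σ < 1 the
quantity φ_k^σ eventually dominates φ_k, so the violation would become negative.

If it is the second, d₀^k is bounded and converges along U to some d*. When (d*, φ(x*)) ≠ (0,0),
both the step length and the guaranteed decrease per unit step stay bounded below
(`exists_search₂`), contradicting vanishing decrements. When (d*, φ(x*)) = (0,0), x* is a KKT point
and the multipliers converge along U (`exists_tendsto_multiplier`). The Hessian approximation
condition then makes the unit corrected step pass the direction test and the first search
(`eventually_unit_step`), so the second search would not have been entered.

Both acceptance results rest on the uniform bound `exists_SLE_bound` for the linear systems. -/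

namespace SubfeasibleSQP
open Filter Topology

/-! ### Quadratic forms and operator norms. -/

section act
variable {n : ℕ} (B : Matrix (Fin n) (Fin n) ℝ)

lemma act_eq_toEuclideanLin (d : E n) : act B d = Matrix.toEuclideanLin B d := rfl

variable {B}

lemma inner_act_comm (hB : B.PosDef) (u v : E n) :
    inner ℝ (act B u) v = inner ℝ u (act B v) := by
  rw [act_eq_toEuclideanLin, act_eq_toEuclideanLin]
  exact (Matrix.isSymmetric_toEuclideanLin_iff.mpr hB.isHermitian) u v

/-- A symmetric positive definite form bounded by `b` has operator norm at most `b`. -/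
lemma norm_act_le (hB : B.PosDef) {a b : ℝ} (ha : 0 < a) (hb : 0 < b)
    (h : ∀ d : E n, a * ‖d‖ ^ 2 ≤ inner ℝ d (act B d) ∧ inner ℝ d (act B d) ≤ b * ‖d‖ ^ 2)
    (d : E n) : ‖act B d‖ ≤ b * ‖d‖ := by
  set v := act B d with hv
  -- With v = Bd, expanding the form at bd - v and using its upper bound at d and at v leaves b‖v‖²
  -- ≤ b³‖d‖².
  have h1 : 0 ≤ inner ℝ (b • d - v) (act B (b • d - v)) :=
    le_trans (by positivity) (h (b • d - v)).1
  have h2 : inner ℝ (b • d - v) (act B (b • d - v)) =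
      b ^ 2 * inner ℝ d v - 2 * b * ‖v‖ ^ 2 + inner ℝ v (act B v) := by
    have e1 : act B (b • d - v) = b • v - act B v := by
      rw [hv]; simp only [act_eq_toEuclideanLin, map_sub, map_smul]
    have e2 : inner ℝ d (act B v) = ‖v‖ ^ 2 := by
      rw [← inner_act_comm hB, ← hv, real_inner_self_eq_norm_sq]
    have e3 : inner ℝ v v = ‖v‖ ^ 2 := real_inner_self_eq_norm_sq v
    rw [e1]
    simp only [inner_sub_left, inner_sub_right, real_inner_smul_left, real_inner_smul_right, e2, e3]
    ring
  have h3 := (h v).2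
  have h4 := (h d).2
  rw [← hv] at h4
  have h5 : b * ‖v‖ ^ 2 ≤ b * (b * ‖d‖) ^ 2 := by
    nlinarith [mul_le_mul_of_nonneg_left h4 (sq_nonneg b)]
  exact (le_abs_self _).trans
    (abs_le_of_sq_le_sq (le_of_mul_le_mul_left h5 hb) (by positivity))
end act

/-! ### Constraint violation and shifted constraints. -/

namespace NCP
variable {n m : ℕ} (P : NCP n m)

lemma viol_le_iff {x : E n} {c : ℝ} : P.viol x ≤ c ↔ 0 ≤ c ∧ ∀ j, P.f j x ≤ c := by
  simp [viol, Finset.fold_max_le]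

lemma viol_nonneg (x : E n) : 0 ≤ P.viol x := (P.viol_le_iff.1 le_rfl).1

lemma le_viol (j : Fin m) (x : E n) : P.f j x ≤ P.viol x := (P.viol_le_iff.1 le_rfl).2 j

lemma viol_eq_zero_iff {x : E n} : P.viol x = 0 ↔ x ∈ P.feasible := by
  rw [le_antisymm_iff, P.viol_le_iff]
  simp [feasible, viol_nonneg]

lemma continuous_viol (h : ∀ j, Continuous (P.f j)) : Continuous P.viol := by
  unfold viol
  induction (Finset.univ : Finset (Fin m)) using Finset.induction_on with
  | empty => simpa using continuous_const
  | insert j s hj ih =>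
    simp only [Finset.fold_insert hj]
    exact (h j).max ih

lemma fbar_nonpos (j : Fin m) (x : E n) : P.fbar j x ≤ 0 := by
  unfold fbar
  split_ifs with h
  · exact h
  · linarith [P.le_viol j x]

lemma fbar_of_nonpos {j : Fin m} {x : E n} (h : P.f j x ≤ 0) : P.fbar j x = P.f j x := if_pos h

lemma fbar_of_pos {j : Fin m} {x : E n} (h : 0 < P.f j x) :
    P.fbar j x = P.f j x - P.viol x := if_neg (not_le.2 h)

lemma abs_fbar_sub_le (j : Fin m) (x : E n) : |P.fbar j x - P.f j x| ≤ P.viol x := by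
  have := P.viol_nonneg x
  unfold fbar
  split_ifs <;> simp [abs_of_nonneg this, this]

lemma diag_nonneg (x d : E n) (j : Fin m) : 0 ≤ P.diag x d j := by
  unfold diag; positivity

/-- An inactive constraint stays uniformly inactive in a neighbourhood. -/
lemma exists_lt_abs_fbar (h : ∀ j, Continuous (P.f j)) {j : Fin m} {xs : E n}
    (hj : P.fbar j xs ≠ 0) : ∃ c > 0, ∀ᶠ y in 𝓝 xs, c ≤ |P.fbar j y| := by
  have hv := P.continuous_viol h
  rcases le_or_gt (P.f j xs) 0 with h0 | h0
  · rw [P.fbar_of_nonpos h0] at hj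
    have h1 : P.f j xs < 0 := lt_of_le_of_ne h0 hj
    refine ⟨-(P.f j xs / 2), by linarith, ?_⟩
    filter_upwards [(h j).continuousAt.eventually_lt continuousAt_const
      (show P.f j xs < P.f j xs / 2 by linarith)] with y hy
    rw [P.fbar_of_nonpos (by linarith)]
    exact le_trans (by linarith) (neg_le_abs _)
  · rw [P.fbar_of_pos h0] at hj
    have h1 : P.f j xs - P.viol xs < 0 :=
      lt_of_le_of_ne (by linarith [P.le_viol j xs]) hj
    refine ⟨-((P.f j xs - P.viol xs) / 2), by linarith, ?_⟩
    filter_upwards [((h j).sub hv).continuousAt.eventually_lt continuousAt_const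
      (show P.f j xs - P.viol xs < (P.f j xs - P.viol xs) / 2 by linarith),
      (h j).continuousAt.eventually_const_lt h0] with y hy hy0
    rw [Pi.sub_apply] at hy
    rw [P.fbar_of_pos hy0]
    exact le_trans (by linarith) (neg_le_abs _)

/-- The diagonal entries of the linear system dominate the square of the shifted constraint. -/
lemma sq_fbar_le_diag (x d : E n) (j : Fin m) :
    |P.fbar j x| ^ 2 ≤ (1 + ‖P.g j x‖) * P.diag x d j := by
  have h1 := abs_real_inner_le_norm (P.g j x) d
  have h2 : |P.fbar j x| ≤ |P.fbar j x + inner ℝ (P.g j x) d| + |inner ℝ (P.g j x) d| := by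
    simpa using abs_sub (P.fbar j x + inner ℝ (P.g j x) d) (inner ℝ (P.g j x) d)
  unfold diag
  have h3 : |P.fbar j x| ≤
      (1 + ‖P.g j x‖) * (|P.fbar j x + inner ℝ (P.g j x) d| + ‖d‖) := by
    nlinarith [norm_nonneg (P.g j x), norm_nonneg d,
      mul_nonneg (norm_nonneg (P.g j x)) (abs_nonneg (P.fbar j x + inner ℝ (P.g j x) d))]
  nlinarith [mul_le_mul_of_nonneg_left h3 (abs_nonneg (P.fbar j x))]

end NCP

/-! ### Taylor estimates uniform near a point. -/

section Taylor
variable {n : ℕ} {f : E n → ℝ}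

lemma contDiff_gradient (hf : ContDiff ℝ 2 f) : ContDiff ℝ 1 (gradient f) := by
  have : gradient f = fun y => (InnerProductSpace.toDual ℝ (E n)).symm (fderiv ℝ f y) := rfl
  rw [this]
  exact (InnerProductSpace.toDual ℝ (E n)).symm.contDiff.comp
    (hf.fderiv_right (m := 1) (by norm_num))

lemma fderiv_eq_inner_gradient (y d : E n) : fderiv ℝ f y d = inner ℝ (gradient f y) d :=
  (InnerProductSpace.toDual_symm_apply).symm

/-- First-order expansion with a gradient taken at a third nearby point. -/
lemma exists_first_order_bound (hf : ContDiff ℝ 2 f) (x₀ : E n) :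
    ∃ M > 0, ∃ r > 0, ∀ w ∈ Metric.ball x₀ r, ∀ y ∈ Metric.ball x₀ r, ∀ z ∈ Metric.ball x₀ r,
      |f y - f z - inner ℝ (gradient f w) (y - z)| ≤ M * (‖y - w‖ + ‖z - w‖) * ‖y - z‖ := by
  obtain ⟨K, t, ht, hK⟩ := (contDiff_gradient hf).contDiffAt.exists_lipschitzOnWith (x := x₀)
  obtain ⟨r, hr, hrt⟩ := Metric.mem_nhds_iff.1 ht
  refine ⟨K + 1, by positivity, r, hr, fun w hw y hy z hz => ?_⟩
  have hseg : segment ℝ z y ⊆ Metric.ball x₀ r := (convex_ball x₀ r).segment_subset hz hy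
  have hd : Differentiable ℝ f := hf.differentiable (by norm_num)
  -- Mean value inequality against the fixed linear map at w: the gradient is Lipschitz, and by
  -- convexity of the norm no point of the segment is farther from w than an endpoint. `K + 1` only
  -- makes the constant positive.
  have key := (convex_segment z y).norm_image_sub_le_of_norm_hasFDerivWithin_le' (𝕜 := ℝ)
    (f := f) (f' := fderiv ℝ f) (φ := fderiv ℝ f w) (C := (K + 1) * (‖y - w‖ + ‖z - w‖))
    (fun p _ => (hd p).hasFDerivAt.hasFDerivWithinAt)
    (fun p hp => by
      have h1 : ‖fderiv ℝ f p - fderiv ℝ f w‖ = ‖gradient f p - gradient f w‖ := by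
        rw [gradient, gradient, ← map_sub, LinearIsometryEquiv.norm_map]
      have h2 := hK.norm_sub_le (hrt (hseg hp)) (hrt hw)
      have h3 : ‖p - w‖ ≤ max ‖z - w‖ ‖y - w‖ := by
        have := (convexOn_norm (convex_univ (𝕜 := ℝ) (E := E n))).translate_left (-w)
        have := this.le_max_of_mem_segment (Set.mem_univ z) (Set.mem_univ y) hp
        simpa [sub_eq_add_neg] using this
      have h4 : max ‖z - w‖ ‖y - w‖ ≤ ‖y - w‖ + ‖z - w‖ :=
        max_le (by linarith [norm_nonneg (y - w)]) (by linarith [norm_nonneg (z - w)])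
      rw [h1]
      refine h2.trans (mul_le_mul (by linarith) (h3.trans h4) (norm_nonneg _) (by positivity)))
    (left_mem_segment ℝ z y) (right_mem_segment ℝ z y)
  rwa [Real.norm_eq_abs, fderiv_eq_inner_gradient] at key

lemma hasDerivAt_taylor_remainder (hf : Differentiable ℝ f) (z d H : E n) (s : ℝ) :
    HasDerivAt
      (fun s : ℝ => f (z + s • d) - s * inner ℝ (gradient f z) d - s ^ 2 / 2 * inner ℝ d H)
      (inner ℝ (gradient f (z + s • d)) d - inner ℝ (gradient f z) d - s * inner ℝ d H) s := by
  have l : HasDerivAt (fun s : ℝ => z + s • d) d s := by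
    simpa using ((hasDerivAt_id s).smul_const d).const_add z
  have a1 : HasDerivAt (fun s : ℝ => f (z + s • d)) (inner ℝ (gradient f (z + s • d)) d) s := by
    rw [← fderiv_eq_inner_gradient]
    exact (hf (z + s • d)).hasFDerivAt.comp_hasDerivAt s l
  have a2 : HasDerivAt (fun s : ℝ => s * inner ℝ (gradient f z) d)
      (inner ℝ (gradient f z) d) s := by
    simpa using (hasDerivAt_id s).mul_const (inner ℝ (gradient f z) d)
  have a3 : HasDerivAt (fun s : ℝ => s ^ 2 / 2 * inner ℝ d H) (s * inner ℝ d H) s := by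
    have := (((hasDerivAt_id s).pow 2).div_const 2).mul_const (inner ℝ d H)
    simpa using this
  exact (a1.sub a2).sub a3

/-- Second-order expansion with the Hessian frozen at a nearby point. -/
lemma exists_second_order_bound (hf : ContDiff ℝ 2 f) (x₀ : E n) {e : ℝ} (he : 0 < e) :
    ∃ r > 0, ∀ z ∈ Metric.ball x₀ r, ∀ d : E n, z + d ∈ Metric.ball x₀ r →
      |f (z + d) - f z - inner ℝ (gradient f z) d -
        1 / 2 * inner ℝ d (fderiv ℝ (gradient f) x₀ d)| ≤ e * ‖d‖ ^ 2 := by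
  -- Strict differentiability is what allows both z and z + sd to move while the Hessian stays
  -- frozen at `x₀`.
  have hs : HasStrictFDerivAt (gradient f) (fderiv ℝ (gradient f) x₀) x₀ :=
    (contDiff_gradient hf).contDiffAt.hasStrictFDerivAt (by norm_num)
  generalize fderiv ℝ (gradient f) x₀ = H at hs ⊢
  obtain ⟨r, hr, hrt⟩ := Metric.eventually_nhds_iff_ball.1 (hs.isLittleO.def he)
  refine ⟨r, hr, fun z hz d hy => ?_⟩
  have hdf : Differentiable ℝ f := hf.differentiable (by norm_num)
  have hbound : ∀ s ∈ Set.Ico (0 : ℝ) 1, ‖inner ℝ (gradient f (z + s • d)) d -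
      inner ℝ (gradient f z) d - s * inner ℝ d (H d)‖ ≤ e * ‖d‖ ^ 2 := fun s hs => by
      have hmem : z + s • d ∈ Metric.ball x₀ r := by
        refine (convex_ball x₀ r).segment_subset hz hy ?_
        rw [segment_eq_image']
        exact ⟨s, ⟨hs.1, hs.2.le⟩, by simp⟩
      have hb : ‖gradient f (z + s • d) - gradient f z - H (z + s • d - z)‖
          ≤ e * ‖z + s • d - z‖ :=
        hrt (z + s • d, z) (by rw [← ball_prod_same]; exact ⟨hmem, hz⟩)
      rw [add_sub_cancel_left] at hb
      have e1 : inner ℝ (gradient f (z + s • d)) d - inner ℝ (gradient f z) d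
          - s * inner ℝ d (H d) =
          inner ℝ (gradient f (z + s • d) - gradient f z - H (s • d)) d := by
        rw [inner_sub_left, inner_sub_left, map_smul, real_inner_smul_left,
          real_inner_comm d (H d)]
      rw [e1]
      refine (norm_inner_le_norm _ _).trans ?_
      rw [norm_smul, Real.norm_eq_abs, abs_of_nonneg hs.1] at hb
      have h2 : e * (s * ‖d‖) ≤ e * ‖d‖ :=
        mul_le_mul_of_nonneg_left (mul_le_of_le_one_left (norm_nonneg d) hs.2.le) he.le
      calc _ ≤ e * ‖d‖ * ‖d‖ := mul_le_mul_of_nonneg_right (hb.trans h2) (norm_nonneg d)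
        _ = e * ‖d‖ ^ 2 := by ring
  have key := norm_image_sub_le_of_norm_deriv_le_segment_01'
    (fun s _ => (hasDerivAt_taylor_remainder hdf z d (H d) s).hasDerivWithinAt) hbound
  rw [Real.norm_eq_abs, one_smul, zero_smul, add_zero] at key
  convert key using 2
  ring

end Taylor

/-! ### Stability of linear independence. -/

section LinearIndependent
variable {n m : ℕ}

/-- A linearly independent subfamily satisfies a uniform lower bound in a neighbourhood. -/
lemma exists_lower_bound_of_linearIndependent {v : Fin m → E n → E n} {x₀ : E n}
    (hv : ∀ j, Continuous (v j)) (S : Fin m → Prop)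
    (hli : LinearIndependent ℝ (fun j : {j : Fin m // S j} => v j x₀)) :
    ∃ c > 0, ∀ᶠ y in 𝓝 x₀, ∀ w : Fin m → ℝ, (∀ j, ¬ S j → w j = 0) →
      c * ‖w‖ ≤ ‖∑ j, w j • v j y‖ := by
  classical
  have hker : LinearMap.ker (Fintype.linearCombination ℝ (fun j : {j : Fin m // S j} => v j x₀))
      = ⊥ := by
    rw [LinearMap.ker_eq_bot]
    exact hli.fintypeLinearCombination_injective
  obtain ⟨K, hK, hanti⟩ := LinearMap.exists_antilipschitzWith _ hker
  have hK' : (0 : ℝ) < K := hK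
  -- A perturbation below 1/(2K) can destroy at most half of the lower bound 1/K valid at `x₀`.
  have hsmall : ∀ᶠ y in 𝓝 x₀, ∑ j, ‖v j y - v j x₀‖ < 1 / (2 * K) := by
    have hc : ContinuousAt (fun y => ∑ j, ‖v j y - v j x₀‖) x₀ := by fun_prop
    exact hc.eventually_lt continuousAt_const (by simpa using hK')
  refine ⟨1 / (2 * K), by positivity, ?_⟩
  filter_upwards [hsmall] with y hy w hw
  have h1 : ‖w‖ ≤ K * ‖∑ j, w j • v j x₀‖ := by
    have h2 := hanti.le_mul_norm (map_zero _) (fun j => w j)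
    have h3 : (Fintype.linearCombination ℝ (fun j : {j : Fin m // S j} => v j x₀))
        (fun j => w j) = ∑ j, w j • v j x₀ := by
      rw [Fintype.linearCombination_apply]
      rw [← Finset.sum_filter_of_ne (s := Finset.univ) (p := S) (f := fun j => w j • v j x₀)
        (fun j _ hj => by_contra fun hS => hj (by rw [hw j hS, zero_smul]))]
      exact (Finset.sum_subtype _ (by simp) (fun j => w j • v j x₀)).symm
    rw [h3] at h2
    refine le_trans ?_ h2
    refine (pi_norm_le_iff_of_nonneg (norm_nonneg _)).2 fun j => ?_
    by_cases hj : S j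
    · exact norm_le_pi_norm (fun j : {j : Fin m // S j} => w j) ⟨j, hj⟩
    · simp [hw j hj]
  have h4 : ‖∑ j, w j • v j x₀‖ ≤ ‖∑ j, w j • v j y‖ + ‖w‖ * ∑ j, ‖v j y - v j x₀‖ := by
    have e : ∑ j, w j • v j x₀ = ∑ j, w j • v j y - ∑ j, w j • (v j y - v j x₀) := by
      rw [← Finset.sum_sub_distrib]
      exact Finset.sum_congr rfl fun j _ => by rw [smul_sub]; abel
    rw [e]
    refine (norm_sub_le _ _).trans (add_le_add_right ?_ _)
    rw [Finset.mul_sum]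
    refine (norm_sum_le _ _).trans (Finset.sum_le_sum fun j _ => ?_)
    rw [norm_smul]
    exact mul_le_mul_of_nonneg_right (norm_le_pi_norm w j) (norm_nonneg _)
  have h5 : ‖w‖ * ∑ j, ‖v j y - v j x₀‖ ≤ ‖w‖ * (1 / (2 * K)) := by gcongr
  have h6 : (K : ℝ) * (‖w‖ * (1 / (2 * K))) = ‖w‖ / 2 := by field_simp
  have h7 : ‖w‖ ≤ 2 * K * ‖∑ j, w j • v j y‖ := by
    have := mul_le_mul_of_nonneg_left (h4.trans (add_le_add_right h5 _)) hK'.le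
    rw [mul_add, h6] at this
    linarith
  rw [div_mul_eq_mul_div, one_mul, div_le_iff₀ (by positivity)]
  linarith

end LinearIndependent

/-! ### Uniform bounds for the linear systems and the quadratic programs. -/

/-- The bounds `a ‖d‖² ≤ dᵀ B d ≤ b ‖d‖²` for a positive definite matrix. -/
structure FormBounds {n : ℕ} (a b : ℝ) (B : Matrix (Fin n) (Fin n) ℝ) : Prop where
  posDef : B.PosDef
  bounds : ∀ d : E n,
    a * ‖d‖ ^ 2 ≤ inner ℝ d (act B d) ∧ inner ℝ d (act B d) ≤ b * ‖d‖ ^ 2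

lemma exists_pos_forall_le {m : ℕ} (r : Fin m → ℝ) (hr : ∀ j, 0 < r j) :
    ∃ s > 0, ∀ j, s ≤ r j := by
  have h : ∀ᶠ s in 𝓝[>] (0 : ℝ), ∀ j, s ≤ r j :=
    eventually_all.2 fun j => nhdsWithin_le_nhds (eventually_le_nhds (hr j))
  obtain ⟨s, hs, hs0⟩ := (h.and self_mem_nhdsWithin).exists
  exact ⟨s, hs0, hs⟩

namespace NCP
variable {n m : ℕ} {P : NCP n m}

lemma IsC2.continuous_f (h : P.IsC2) (j : Fin m) : Continuous (P.f j) := (h.2 j).continuous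

lemma IsC2.continuous_g (h : P.IsC2) (j : Fin m) : Continuous (P.g j) :=
  (contDiff_gradient (h.2 j)).continuous

lemma IsC2.continuous_g₀ (h : P.IsC2) : Continuous P.g₀ := (contDiff_gradient h.1).continuous

/-- Local bounds on all the data of the problem. -/
lemma IsC2.exists_local_bound (h : P.IsC2) (xs : E n) :
    ∃ G > 0, ∀ᶠ y in 𝓝 xs, ‖P.g₀ y‖ ≤ G ∧ P.viol y ≤ G ∧
      ∀ j, ‖P.g j y‖ ≤ G ∧ |P.fbar j y| ≤ G := by
  have h0 : ∀ u : E n → ℝ, Continuous u → ∀ᶠ G in atTop, ∀ᶠ y in 𝓝 xs, u y ≤ G := fun u hu => by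
    filter_upwards [eventually_gt_atTop (u xs)] with G hG
    exact hu.continuousAt.eventually_le_const hG
  have hv := P.continuous_viol h.continuous_f
  have h1 := h0 _ h.continuous_g₀.norm
  have h2 := h0 _ hv
  have h3 := eventually_all.2 fun j => h0 _ (h.continuous_g j).norm
  have h4 := eventually_all.2 fun j => h0 _ (hv.add (h.continuous_f j).abs)
  obtain ⟨G, hG, hG1, hG2, hG3, hG4⟩ :=
    ((eventually_gt_atTop (0 : ℝ)).and (h1.and (h2.and (h3.and h4)))).exists
  refine ⟨G, hG, ?_⟩
  filter_upwards [hG1, hG2, eventually_all.2 hG3, eventually_all.2 hG4] with y y1 y2 y3 y4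
  refine ⟨y1, y2, fun j => ⟨y3 j, ?_⟩⟩
  have h5 := P.abs_fbar_sub_le j y
  have h6 := abs_add_le (P.fbar j y - P.f j y) (P.f j y)
  rw [sub_add_cancel] at h6
  exact h6.trans ((add_le_add_left h5 _).trans (y4 j))

/-- First-order expansions of all the functions with uniform constants. -/
lemma IsC2.exists_first_order_bound (h : P.IsC2) (xs : E n) :
    ∃ M > 0, ∃ r > 0, ∀ w ∈ Metric.ball xs r, ∀ y ∈ Metric.ball xs r, ∀ z ∈ Metric.ball xs r,
      |P.f₀ y - P.f₀ z - inner ℝ (P.g₀ w) (y - z)| ≤ M * (‖y - w‖ + ‖z - w‖) * ‖y - z‖ ∧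
      ∀ j, |P.f j y - P.f j z - inner ℝ (P.g j w) (y - z)| ≤
        M * (‖y - w‖ + ‖z - w‖) * ‖y - z‖ := by
  obtain ⟨M₀, hM₀, r₀, hr₀, h₀⟩ := SubfeasibleSQP.exists_first_order_bound h.1 xs
  choose M hM r hr hb using fun j => SubfeasibleSQP.exists_first_order_bound (h.2 j) xs
  obtain ⟨s, hs, hsr⟩ := exists_pos_forall_le r hr
  have hsum : 0 ≤ ∑ j, M j := Finset.sum_nonneg fun j _ => (hM j).le
  refine ⟨M₀ + ∑ j, M j, by linarith, min r₀ s, lt_min hr₀ hs, fun w hw y hy z hz => ⟨?_, ?_⟩⟩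
  · have hsub := Metric.ball_subset_ball (x := xs) (min_le_left r₀ s)
    refine (h₀ w (hsub hw) y (hsub hy) z (hsub hz)).trans ?_
    gcongr
    linarith
  · intro j
    have hsub := Metric.ball_subset_ball (x := xs) ((min_le_right r₀ s).trans (hsr j))
    refine (hb j w (hsub hw) y (hsub hy) z (hsub hz)).trans ?_
    have := Finset.single_le_sum (f := M) (fun i _ => (hM i).le) (Finset.mem_univ j)
    gcongr
    linarith

/-- Energy identity for the block linear system. -/
lemma SolvesSLE.energy {x : E n} {B : Matrix (Fin n) (Fin n) ℝ} {d₀ d : E n} {r h : Fin m → ℝ}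
    (hs : P.SolvesSLE x B d₀ r d h) :
    inner ℝ d (act B d) + ∑ j, P.diag x d₀ j * h j ^ 2 = -∑ j, h j * r j := by
  have h1 : inner ℝ d (act B d + ∑ j, h j • P.g j x) = 0 := by rw [hs.1, inner_zero_right]
  rw [inner_add_right, inner_sum] at h1
  have h2 : ∑ j, inner ℝ d (h j • P.g j x) =
      ∑ j, P.diag x d₀ j * h j ^ 2 + ∑ j, h j * r j := by
    rw [← Finset.sum_add_distrib]
    refine Finset.sum_congr rfl fun j _ => ?_
    rw [real_inner_smul_right, real_inner_comm, ← hs.2 j]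
    ring
  rw [h2] at h1
  linarith

/-- An inactive shifted constraint stays away from 0, and by `sq_fbar_le_diag` it forces a diagonal
entry bounded below whatever d is, even d = 0. -/
lemma exists_le_diag (h : P.IsC2) (xs : E n) :
    ∃ C ≥ 0, ∀ᶠ y in 𝓝 xs, ∀ d j, P.fbar j xs ≠ 0 → 1 ≤ C * P.diag y d j := by
  obtain ⟨G, hG, hGy⟩ := h.exists_local_bound xs
  have key : ∀ j, ∃ C ≥ 0, ∀ᶠ y in 𝓝 xs, ∀ d, P.fbar j xs ≠ 0 → 1 ≤ C * P.diag y d j := by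
    intro j
    by_cases hj : P.fbar j xs = 0
    · exact ⟨0, le_rfl, Eventually.of_forall fun y d hne => absurd hj hne⟩
    · obtain ⟨c, hc, hcy⟩ := P.exists_lt_abs_fbar h.continuous_f hj
      refine ⟨(1 + G) / c ^ 2, by positivity, ?_⟩
      filter_upwards [hcy, hGy] with y hy hgy d _
      have h1 := P.sq_fbar_le_diag y d j
      have h2 : c ^ 2 ≤ |P.fbar j y| ^ 2 := by gcongr
      have h3 : (1 + ‖P.g j y‖) * P.diag y d j ≤ (1 + G) * P.diag y d j :=
        mul_le_mul_of_nonneg_right (by linarith [(hgy.2.2 j).1]) (P.diag_nonneg y d j)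
      rw [div_mul_eq_mul_div, le_div_iff₀ (by positivity)]
      linarith
  choose C hC hCy using key
  refine ⟨∑ j, C j, Finset.sum_nonneg fun j _ => hC j, ?_⟩
  filter_upwards [eventually_all.2 hCy] with y hy d j hj
  refine (hy j d hj).trans (mul_le_mul_of_nonneg_right ?_ (P.diag_nonneg y d j))
  exact Finset.single_le_sum (f := C) (fun i _ => hC i) (Finset.mem_univ j)

lemma norm_sum_smul_le {F : Type*} [NormedAddCommGroup F] [NormedSpace ℝ F] {w : Fin m → ℝ}
    {v : Fin m → F} {G : ℝ} (hv : ∀ j, ‖v j‖ ≤ G) : ‖∑ j, w j • v j‖ ≤ m * G * ‖w‖ := by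
  refine (norm_sum_le _ _).trans ?_
  have : ∀ j ∈ Finset.univ, ‖w j • v j‖ ≤ G * ‖w‖ := fun j _ => by
    rw [norm_smul, mul_comm]
    exact mul_le_mul (hv j) (norm_le_pi_norm w j) (norm_nonneg _) ((norm_nonneg _).trans (hv j))
  refine (Finset.sum_le_card_nsmul _ _ _ this).trans ?_
  simp [mul_assoc]

/-- Solutions of the block linear systems are bounded by their right-hand sides, uniformly in a
neighbourhood of a point at which the active gradients are linearly independent. -/
lemma exists_SLE_bound (h : P.IsC2) (hli : P.GradIndep) (xs : E n) {a b : ℝ} (ha : 0 < a)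
    (hb : 0 < b) :
    ∃ C > 0, ∀ᶠ y in 𝓝 xs, ∀ (B : Matrix (Fin n) (Fin n) ℝ) (d₀ d : E n) (r w : Fin m → ℝ),
      FormBounds a b B → P.SolvesSLE y B d₀ r d w → ‖d‖ ≤ C * ‖r‖ ∧ ‖w‖ ≤ C * ‖r‖ := by
  classical
  obtain ⟨c, hc, hcy⟩ := exists_lower_bound_of_linearIndependent h.continuous_g
    (fun j => P.fbar j xs = 0) (hli xs)
  obtain ⟨G, hG, hGy⟩ := h.exists_local_bound xs
  obtain ⟨D, hD, hDy⟩ := exists_le_diag h xs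
  set K : ℝ := 2 * (b / c) ^ 2 / a + 2 * (m * G / c + 1) ^ 2 * D with hK
  have hK0 : 0 ≤ K := by positivity
  refine ⟨m * K + m / a + 1, by positivity, ?_⟩
  filter_upwards [hcy, hGy, hDy] with y h1 h2 h3 B d₀ d r w hB hs
  have hen := hs.energy
  set X : ℝ := m * (‖w‖ * ‖r‖) with hX
  have hX1 : -∑ j, w j * r j ≤ X := by
    rw [← Finset.sum_neg_distrib]
    refine (Finset.sum_le_card_nsmul _ _ (‖w‖ * ‖r‖) fun j _ => ?_).trans (by simp [hX])
    refine (neg_le_abs _).trans ?_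
    rw [abs_mul]
    exact mul_le_mul (norm_le_pi_norm w j) (norm_le_pi_norm r j) (abs_nonneg _) (norm_nonneg _)
  have hsum0 : 0 ≤ ∑ j, P.diag y d₀ j * w j ^ 2 :=
    Finset.sum_nonneg fun j _ => mul_nonneg (P.diag_nonneg y d₀ j) (sq_nonneg _)
  have hd : a * ‖d‖ ^ 2 ≤ X := by linarith [(hB.bounds d).1]
  have hs1 : ∑ j, P.diag y d₀ j * w j ^ 2 ≤ X := by
    have : 0 ≤ a * ‖d‖ ^ 2 := by positivity
    linarith [(hB.bounds d).1]
  have hX0 : 0 ≤ X := by positivity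
  -- Split the multipliers: the inactive part u is controlled by the diagonal term of the energy
  -- identity, the active part w - u by linear independence in the first equation of the system.
  set u : Fin m → ℝ := fun j => if P.fbar j xs = 0 then 0 else w j with hu
  have hu2 : ‖u‖ ^ 2 ≤ D * X := by
    have h4 : ∀ j, u j ^ 2 ≤ D * (P.diag y d₀ j * w j ^ 2) := by
      intro j
      by_cases hj : P.fbar j xs = 0
      · have h0 : u j = 0 := by simp [hu, hj]
        have := P.diag_nonneg y d₀ j
        rw [h0, zero_pow two_ne_zero]
        positivity
      · simp only [hu, hj, if_false]
        nlinarith [h3 d₀ j hj, sq_nonneg (w j)]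
    have h5 : ∀ j, u j ^ 2 ≤ D * X := fun j => (h4 j).trans <|
      mul_le_mul_of_nonneg_left ((Finset.single_le_sum
        (f := fun j => P.diag y d₀ j * w j ^ 2)
        (fun i _ => mul_nonneg (P.diag_nonneg y d₀ i) (sq_nonneg _))
        (Finset.mem_univ j)).trans hs1) hD
    have h6 : ‖u‖ ≤ √(D * X) := (pi_norm_le_iff_of_nonneg (Real.sqrt_nonneg _)).2 fun j => by
      rw [Real.norm_eq_abs]
      exact Real.abs_le_sqrt (h5 j)
    calc ‖u‖ ^ 2 ≤ √(D * X) ^ 2 := by gcongr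
      _ = D * X := Real.sq_sqrt (by positivity)
  have hwu : c * ‖w - u‖ ≤ b * ‖d‖ + m * G * ‖u‖ := by
    refine (h1 (w - u) fun j hj => by simp [hu, hj]).trans ?_
    have e : ∑ j, (w - u) j • P.g j y = -act B d - ∑ j, u j • P.g j y := by
      rw [eq_sub_iff_add_eq, ← Finset.sum_add_distrib, eq_neg_iff_add_eq_zero, add_comm, ← hs.1]
      congr 1
      exact Finset.sum_congr rfl fun j _ => by rw [Pi.sub_apply, sub_smul]; abel
    rw [e]
    refine (norm_sub_le _ _).trans (add_le_add ?_ (norm_sum_smul_le fun j => (h2.2.2 j).1))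
    rw [norm_neg]
    exact norm_act_le hB.posDef ha hb hB.bounds d
  have hw : ‖w‖ ≤ b / c * ‖d‖ + (m * G / c + 1) * ‖u‖ := by
    have h4 : ‖w‖ ≤ ‖w - u‖ + ‖u‖ := by simpa using norm_add_le (w - u) u
    have h5 : ‖w - u‖ ≤ (b * ‖d‖ + m * G * ‖u‖) / c := by
      rw [le_div_iff₀ hc]; linarith
    have h6 : (b * ‖d‖ + m * G * ‖u‖) / c = b / c * ‖d‖ + m * G / c * ‖u‖ := by ring
    linarith
  -- As X is a multiple of ‖w‖‖r‖, one factor ‖w‖ will cancel and leave a bound linear in ‖r‖.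
  have hw2 : ‖w‖ ^ 2 ≤ K * X := by
    have h4 : ‖d‖ ^ 2 ≤ X / a := by rw [le_div_iff₀ ha]; linarith
    calc ‖w‖ ^ 2 ≤ (b / c * ‖d‖ + (m * G / c + 1) * ‖u‖) ^ 2 := by gcongr
      _ ≤ 2 * (b / c) ^ 2 * ‖d‖ ^ 2 + 2 * (m * G / c + 1) ^ 2 * ‖u‖ ^ 2 := by
        nlinarith [sq_nonneg (b / c * ‖d‖ - (m * G / c + 1) * ‖u‖)]
      _ ≤ 2 * (b / c) ^ 2 * (X / a) + 2 * (m * G / c + 1) ^ 2 * (D * X) := by gcongr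
      _ = K * X := by rw [hK]; ring
  have hwr : ‖w‖ ≤ m * K * ‖r‖ := by
    rcases (norm_nonneg w).eq_or_lt with h0 | h0
    · rw [← h0]; positivity
    · refine le_of_mul_le_mul_left ?_ h0
      calc ‖w‖ * ‖w‖ = ‖w‖ ^ 2 := by ring
        _ ≤ K * X := hw2
        _ = ‖w‖ * (m * K * ‖r‖) := by rw [hX]; ring
  have hmono : ∀ s : ℝ, 0 ≤ s → m * K * s ≤ (m * K + m / a + 1) * s := fun s hs => by
    gcongr
    have : 0 ≤ (m : ℝ) / a := by positivity
    linarith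
  refine ⟨?_, hwr.trans (hmono _ (norm_nonneg r))⟩
  refine (le_abs_self _).trans (abs_le_of_sq_le_sq ?_ (by positivity))
  have h4 : ‖d‖ ^ 2 ≤ m / a * (m * K) * ‖r‖ ^ 2 := by
    have h5 : ‖d‖ ^ 2 ≤ X / a := by rw [le_div_iff₀ ha]; linarith
    calc ‖d‖ ^ 2 ≤ X / a := h5
      _ ≤ m * (m * K * ‖r‖ * ‖r‖) / a := by rw [hX]; gcongr
      _ = _ := by ring
  refine h4.trans ?_
  rw [mul_pow]
  gcongr
  have : 0 ≤ (m : ℝ) / a := by positivity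
  have : 0 ≤ m * K := by positivity
  nlinarith

namespace QPSolution
variable {x d₀ : E n} {B : Matrix (Fin n) (Fin n) ℝ} {lam : Fin m → ℝ}

/-- Pair stationarity with d₀: complementarity turns each multiplier term into -λ_j f̄_j ≥ 0. -/
lemma inner_g₀_le (h : P.QPSolution x B d₀ lam) :
    inner ℝ (P.g₀ x) d₀ ≤ -inner ℝ d₀ (act B d₀) := by
  have h1 : inner ℝ (P.g₀ x + act B d₀ + ∑ j, lam j • P.g j x) d₀ = 0 := by
    rw [h.stationary, inner_zero_left]
  rw [inner_add_left, inner_add_left, sum_inner, real_inner_comm d₀ (act B d₀)] at h1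
  have h2 : 0 ≤ ∑ j, inner ℝ (lam j • P.g j x) d₀ := Finset.sum_nonneg fun j _ => by
    rw [real_inner_smul_left]
    nlinarith [h.compl j, mul_nonneg (h.dual j) (neg_nonneg.2 (P.fbar_nonpos j x))]
  linarith

lemma inner_g₀_le_neg_sq (h : P.QPSolution x B d₀ lam) {a b : ℝ} (hB : FormBounds a b B) :
    inner ℝ (P.g₀ x) d₀ ≤ -(a * ‖d₀‖ ^ 2) := by
  linarith [h.inner_g₀_le, (hB.bounds d₀).1]

lemma norm_le (h : P.QPSolution x B d₀ lam) {a b : ℝ} (ha : 0 < a) (hB : FormBounds a b B) :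
    ‖d₀‖ ≤ ‖P.g₀ x‖ / a := by
  rw [le_div_iff₀ ha]
  rcases (norm_nonneg d₀).eq_or_lt with h0 | h0
  · rw [← h0]; simp
  · refine le_of_mul_le_mul_left ?_ h0
    nlinarith [h.inner_g₀_le_neg_sq hB, neg_abs_le (inner ℝ (P.g₀ x) d₀),
      abs_real_inner_le_norm (P.g₀ x) d₀]

end QPSolution
end NCP

/-! ### The weight β and the second line search. -/

namespace Params
variable {n m : ℕ} {P : NCP n m} (p : Params)

section weight
variable {x d₀ dt : E n}

lemma beta_le_one : p.beta P x d₀ dt ≤ 1 := by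
  unfold beta
  split_ifs
  · exact min_le_left _ _
  · exact le_rfl

lemma beta_numerator_nonneg (h : inner ℝ (P.g₀ x) d₀ ≤ 0) :
    0 ≤ (p.θ - 1) * inner ℝ (P.g₀ x) d₀ + P.viol x ^ p.θ :=
  add_nonneg (mul_nonneg_of_nonpos_of_nonpos (by linarith [p.θ_lt, p.σ_lt]) h)
    (Real.rpow_nonneg (P.viol_nonneg x) _)

lemma beta_nonneg (h : inner ℝ (P.g₀ x) d₀ ≤ 0) : 0 ≤ p.beta P x d₀ dt := by
  unfold beta
  split_ifs with h1
  · exact le_min zero_le_one (div_nonneg (p.beta_numerator_nonneg h) (by linarith))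
  · exact zero_le_one

/-- The weight makes `q` inherit a fraction of the descent of `d₀`, up to the violation. -/
lemma inner_g₀_qdir_le (h : inner ℝ (P.g₀ x) d₀ ≤ 0) :
    inner ℝ (P.g₀ x) (p.qdir P x d₀ dt) ≤
      p.θ * inner ℝ (P.g₀ x) d₀ + P.viol x ^ p.θ := by
  have hN := p.beta_numerator_nonneg h
  have hv := Real.rpow_nonneg (P.viol_nonneg x) p.θ
  rw [qdir, inner_add_right, real_inner_smul_right, real_inner_smul_right]
  by_cases h1 : inner ℝ (P.g₀ x) d₀ < inner ℝ (P.g₀ x) dt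
  · have hb : p.beta P x d₀ dt ≤ ((p.θ - 1) * inner ℝ (P.g₀ x) d₀ + P.viol x ^ p.θ) /
        (inner ℝ (P.g₀ x) dt - inner ℝ (P.g₀ x) d₀) := by
      rw [beta, if_pos h1]; exact min_le_right _ _
    rw [le_div_iff₀ (by linarith)] at hb
    linarith
  · have hb : p.beta P x d₀ dt = 1 := by rw [beta, if_neg h1]
    rw [hb]
    nlinarith [p.θ_lt, p.σ_lt]

lemma norm_qdir_le (h : inner ℝ (P.g₀ x) d₀ ≤ 0) {R : ℝ} (h0 : ‖d₀‖ ≤ R) (h1 : ‖dt‖ ≤ R) :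
    ‖p.qdir P x d₀ dt‖ ≤ R := by
  have hb := p.beta_nonneg (dt := dt) h
  have hb1 := p.beta_le_one (P := P) (x := x) (d₀ := d₀) (dt := dt)
  refine (norm_add_le _ _).trans ?_
  rw [norm_smul, norm_smul, Real.norm_of_nonneg hb, Real.norm_of_nonneg (by linarith)]
  nlinarith

lemma le_beta (h : inner ℝ (P.g₀ x) d₀ ≤ 0) {ν Δ : ℝ} (hΔ : 0 < Δ)
    (hν : ν ≤ (p.θ - 1) * inner ℝ (P.g₀ x) d₀ + P.viol x ^ p.θ)
    (hd : inner ℝ (P.g₀ x) dt - inner ℝ (P.g₀ x) d₀ ≤ Δ) :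
    min 1 (ν / Δ) ≤ p.beta P x d₀ dt := by
  unfold beta
  split_ifs with h1
  · refine min_le_min le_rfl ?_
    rw [div_le_div_iff₀ hΔ (by linarith)]
    have h2 := p.beta_numerator_nonneg h
    nlinarith
  · exact min_le_left _ _

end weight

section tilde
variable {x d₀ dt : E n} {B : Matrix (Fin n) (Fin n) ℝ} {lam ht : Fin m → ℝ}

lemma norm_rhsTilde_le : ‖p.rhsTilde P x d₀‖ ≤ ‖d₀‖ + P.viol x ^ p.σ := by
  have hv := Real.rpow_nonneg (P.viol_nonneg x) p.σ
  refine (pi_norm_le_iff_of_nonneg (by positivity)).2 fun j => ?_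
  rw [rhsTilde, norm_neg, Real.norm_of_nonneg (by positivity)]

/-- The direction d₀ satisfies the linearised constraint, while the term D_j h_j in the system for
d̃ carries the factor |f̄_j|. Both contributions are therefore absorbed by the slack -f̄_j once t(1
+ A) ≤ 1, leaving the full decrease prescribed by the right-hand side. -/
lemma fbar_add_inner_qdir_le (hqp : P.QPSolution x B d₀ lam)
    (hg : inner ℝ (P.g₀ x) d₀ ≤ 0) (hs : P.SolvesSLE x B d₀ (p.rhsTilde P x d₀) dt ht)
    {j : Fin m} {A t : ℝ}
    (hA : (|P.fbar j x + inner ℝ (P.g j x) d₀| + ‖d₀‖) * |ht j| ≤ A) (ht0 : 0 ≤ t)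
    (htA : t * (1 + A) ≤ 1) :
    P.fbar j x + t * inner ℝ (P.g j x) (p.qdir P x d₀ dt) ≤
      -(t * p.beta P x d₀ dt * (‖d₀‖ + P.viol x ^ p.σ)) := by
  have hb := p.beta_nonneg (dt := dt) hg
  have hb1 := p.beta_le_one (P := P) (x := x) (d₀ := d₀) (dt := dt)
  set β := p.beta P x d₀ dt with hβ
  have hf := P.fbar_nonpos j x
  have h1 := hs.2 j
  have h2 : P.diag x d₀ j * ht j ≤ -P.fbar j x * A := by
    refine (le_abs_self _).trans ?_
    rw [abs_mul, abs_of_nonneg (P.diag_nonneg x d₀ j), NCP.diag, mul_assoc, abs_of_nonpos hf]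
    exact mul_le_mul_of_nonneg_left hA (by linarith)
  have hA0 : 0 ≤ A := le_trans (by positivity) hA
  rw [qdir, ← hβ, inner_add_right, real_inner_smul_right, real_inner_smul_right]
  rw [rhsTilde] at h1
  have h3 : inner ℝ (P.g j x) dt ≤ -P.fbar j x * A - (‖d₀‖ + P.viol x ^ p.σ) := by linarith
  have h4 : inner ℝ (P.g j x) d₀ ≤ -P.fbar j x := by linarith [hqp.feasible j]
  have h5 : t * ((1 - β) * inner ℝ (P.g j x) d₀ + β * inner ℝ (P.g j x) dt) ≤
      t * ((1 - β) * -P.fbar j x + β * (-P.fbar j x * A - (‖d₀‖ + P.viol x ^ p.σ))) := by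
    gcongr
  have h6 : -P.fbar j x * (t * (1 - β + β * A)) ≤ -P.fbar j x * 1 := by
    refine mul_le_mul_of_nonneg_left (le_trans ?_ htA) (by linarith)
    gcongr
    · linarith
    · exact mul_le_of_le_one_left hA0 hb1
  linarith

end tilde

set_option maxHeartbeats 1000000 in
/-- Away from stationary feasible points, the weight `β` and the steps accepted by the second line
search are bounded below. -/
lemma exists_search₂ (h : P.IsC2) (hli : P.GradIndep) (xs : E n) {a b κ : ℝ} (ha : 0 < a)
    (hb : 0 < b) (hκ : 0 < κ) :
    ∃ T > 0, ∃ ω > 0, ∀ᶠ y in 𝓝 xs, ∀ (B : Matrix (Fin n) (Fin n) ℝ) (d₀ dt : E n)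
      (lam ht : Fin m → ℝ), FormBounds a b B → P.QPSolution y B d₀ lam →
      P.SolvesSLE y B d₀ (p.rhsTilde P y d₀) dt ht → κ ≤ ‖d₀‖ + P.viol y →
      ω ≤ p.beta P y d₀ dt * (‖d₀‖ + P.viol y ^ p.σ) ∧
      ∀ t, 0 < t → t ≤ T → p.Search₂ P y d₀ (p.qdir P y d₀ dt) (p.beta P y d₀ dt) t := by
  obtain ⟨hγ, hγ1⟩ := p.γ_mem
  have hθ := p.θ_pos
  have hθσ := p.θ_lt
  have hσ1 := p.σ_lt
  have hρ := p.ρ_gt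
  obtain ⟨C, hC, hCy⟩ := NCP.exists_SLE_bound h hli xs ha hb
  obtain ⟨G, hG, hGy⟩ := h.exists_local_bound xs
  obtain ⟨M, hM, r, hr, hTay⟩ := h.exists_first_order_bound xs
  -- R bounds d₀, d̃, the multipliers h̃, and hence q. The minima below reflect that ‖d₀‖ or φ is at
  -- least κ/2: ν bounds the numerator of β, and ν₂ bounds ρφ^θ - g₀ᵀq, positive because θ > 0 and ρ
  -- > 1.
  set R : ℝ := (1 + C) * (G / a + G ^ p.σ) with hR
  have hR0 : 0 < R := by positivity
  set A : ℝ := (G + G * R + R) * R with hA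
  set ν : ℝ := min ((1 - p.θ) * (a * (κ / 2) ^ 2)) ((κ / 2) ^ p.θ) with hν
  have h1θ : 0 < 1 - p.θ := by linarith
  have hν0 : 0 < ν := lt_min (by positivity) (by positivity)
  set β₀ : ℝ := min 1 (ν / (2 * G * R)) with hβ₀
  have hβ₀0 : 0 < β₀ := lt_min one_pos (by positivity)
  set ω : ℝ := β₀ * min (κ / 2) ((κ / 2) ^ p.σ) with hω
  have hω0 : 0 < ω := mul_pos hβ₀0 (lt_min (by positivity) (by positivity))
  set ν₂ : ℝ := min (p.θ * (a * (κ / 2) ^ 2)) ((p.ρ - 1) * (κ / 2) ^ p.θ) with hν₂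
  have hρ1 : 0 < p.ρ - 1 := by linarith
  have hν₂0 : 0 < ν₂ := lt_min (by positivity) (by positivity)
  have h1γ : 0 < 1 - p.γ := by linarith
  have hA0 : 0 < A := by positivity
  set μ : ℝ := min ((1 - p.γ) * ω) ((1 - p.γ) * ν₂) with hμ
  have hμ0 : 0 < μ := lt_min (by positivity) (by positivity)
  -- The three thresholds absorb the linear terms into the slack, keep the trial point in the Taylor
  -- ball, and fit the quadratic remainder into the fraction 1 - γ of the predicted decrease.
  refine ⟨min (1 / (1 + A)) (min (r / 2 / R) (μ / (M * R ^ 2))),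
    lt_min (by positivity) (lt_min (by positivity) (by positivity)), ω, hω0, ?_⟩
  filter_upwards [hCy, hGy, Metric.ball_mem_nhds xs (half_pos hr)] with y hCy hGy hy
    B d₀ dt lam ht hB hqp hs hκy
  have hv := P.viol_nonneg y
  have hgd := hqp.inner_g₀_le_neg_sq hB
  have hg0 : inner ℝ (P.g₀ y) d₀ ≤ 0 := hgd.trans (by simp; positivity)
  have hd₀ : ‖d₀‖ ≤ G / a :=
    (hqp.norm_le ha hB).trans (div_le_div_of_nonneg_right hGy.1 ha.le)
  have hrhs : ‖p.rhsTilde P y d₀‖ ≤ G / a + G ^ p.σ :=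
    p.norm_rhsTilde_le.trans (add_le_add hd₀
      (Real.rpow_le_rpow hv hGy.2.1 (by linarith)))
  have hX0 : 0 ≤ G / a + G ^ p.σ := by positivity
  have hCR : C * ‖p.rhsTilde P y d₀‖ ≤ R := by
    rw [hR]
    nlinarith
  have hd₀R : ‖d₀‖ ≤ R := by
    have : 0 ≤ G ^ p.σ := by positivity
    rw [hR]; nlinarith
  obtain ⟨hdt, hht⟩ := hCy B d₀ dt _ ht hB hs
  replace hdt := hdt.trans hCR
  replace hht := hht.trans hCR
  have hqR := p.norm_qdir_le hg0 hd₀R hdt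
  have hβ0 := p.beta_nonneg (dt := dt) hg0
  have hcase : κ / 2 ≤ ‖d₀‖ ∨ κ / 2 ≤ P.viol y := by
    by_contra! hc; linarith [hc.1, hc.2]
  have hvθ := Real.rpow_nonneg hv p.θ
  have hvσ := Real.rpow_nonneg hv p.σ
  have hsq : κ / 2 ≤ ‖d₀‖ → a * (κ / 2) ^ 2 ≤ -inner ℝ (P.g₀ y) d₀ := fun hc => by
    have : a * (κ / 2) ^ 2 ≤ a * ‖d₀‖ ^ 2 := by gcongr
    linarith
  have hβ : β₀ ≤ p.beta P y d₀ dt := by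
    refine p.le_beta hg0 (by positivity) ?_ ?_
    · rcases hcase with hc | hc
      · refine (min_le_left _ _).trans ?_
        have := mul_le_mul_of_nonneg_left (hsq hc) h1θ.le
        linarith
      · refine (min_le_right _ _).trans ?_
        have h1 : (κ / 2) ^ p.θ ≤ P.viol y ^ p.θ :=
          Real.rpow_le_rpow (by positivity) hc hθ.le
        have h2 : 0 ≤ (1 - p.θ) * -inner ℝ (P.g₀ y) d₀ := mul_nonneg h1θ.le (by linarith)
        linarith
    · have h1 := (abs_le.1 ((abs_real_inner_le_norm (P.g₀ y) dt).trans
        (mul_le_mul hGy.1 hdt (norm_nonneg _) hG.le))).2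
      have h2 := (abs_le.1 ((abs_real_inner_le_norm (P.g₀ y) d₀).trans
        (mul_le_mul hGy.1 hd₀R (norm_nonneg _) hG.le))).1
      linarith
  have hω1 : ω ≤ p.beta P y d₀ dt * (‖d₀‖ + P.viol y ^ p.σ) := by
    refine mul_le_mul hβ ?_ (le_min (by positivity) (by positivity)) hβ0
    rcases hcase with hc | hc
    · exact (min_le_left _ _).trans (by linarith)
    · refine (min_le_right _ _).trans ?_
      have h1 : (κ / 2) ^ p.σ ≤ P.viol y ^ p.σ :=
        Real.rpow_le_rpow (by positivity) hc (by linarith)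
      linarith [norm_nonneg d₀]
  refine ⟨hω1, fun t ht0 htT => ?_⟩
  have ht1 : t * (1 + A) ≤ 1 := by
    rw [← le_div_iff₀ (by positivity)]; exact htT.trans (min_le_left _ _)
  have ht2 : t * R ≤ r / 2 := by
    rw [← le_div_iff₀ hR0]
    exact htT.trans ((min_le_right _ _).trans (min_le_left _ _))
  have ht3 : M * (t * R) ^ 2 ≤ t * μ := by
    have h1 : t * (M * R ^ 2) ≤ μ := by
      rw [← le_div_iff₀ (by positivity)]
      exact htT.trans ((min_le_right _ _).trans (min_le_right _ _))
    calc M * (t * R) ^ 2 = t * (t * (M * R ^ 2)) := by ring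
      _ ≤ t * μ := by gcongr
  set q := p.qdir P y d₀ dt with hq
  set β := p.beta P y d₀ dt with hβd
  have htq : ‖t • q‖ ≤ t * R := by
    rw [norm_smul, Real.norm_of_nonneg ht0.le]; gcongr
  have hy1 : y ∈ Metric.ball xs r := Metric.ball_subset_ball (by linarith) hy
  have hy2 : y + t • q ∈ Metric.ball xs r := by
    rw [Metric.mem_ball, dist_eq_norm] at hy ⊢
    have : y + t • q - xs = (y - xs) + t • q := by abel
    rw [this]
    exact (norm_add_le _ _).trans_lt (by linarith)
  obtain ⟨hT₀, hTj⟩ := hTay y hy1 _ hy2 y hy1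
  simp only [add_sub_cancel_left, sub_self, norm_zero, add_zero, real_inner_smul_right]
    at hT₀ hTj
  have hquad : M * ‖t • q‖ * ‖t • q‖ ≤ t * μ := by
    refine le_trans ?_ ht3
    rw [mul_assoc, ← sq]
    gcongr
  -- The quantity f_j - f̄_j equals φ for a violated constraint and 0 for a satisfied one, so a
  -- single estimate serves both tests.
  have hcon : ∀ j, P.f j (y + t • q) ≤
      P.f j y - P.fbar j y - p.γ * t * β * (‖d₀‖ + P.viol y ^ p.σ) := by
    intro j
    have h1 := (abs_le.1 ((hTj j).trans hquad)).2
    have hAj : (|P.fbar j y + inner ℝ (P.g j y) d₀| + ‖d₀‖) * |ht j| ≤ A := by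
      have h2 : |ht j| ≤ R := (norm_le_pi_norm ht j).trans hht
      have h3 : |inner ℝ (P.g j y) d₀| ≤ G * R :=
        (abs_real_inner_le_norm (P.g j y) d₀).trans
          (mul_le_mul (hGy.2.2 j).1 hd₀R (norm_nonneg _) hG.le)
      have h4 := abs_add_le (P.fbar j y) (inner ℝ (P.g j y) d₀)
      have h5 := (hGy.2.2 j).2
      rw [hA]
      exact mul_le_mul (by linarith) h2 (abs_nonneg _) (by positivity)
    have h2 := p.fbar_add_inner_qdir_le hqp hg0 hs hAj ht0.le ht1
    have h3 : t * μ ≤ t * ((1 - p.γ) * (β * (‖d₀‖ + P.viol y ^ p.σ))) :=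
      mul_le_mul_of_nonneg_left ((min_le_left _ _).trans
        (mul_le_mul_of_nonneg_left hω1 h1γ.le)) ht0.le
    rw [← hq, ← hβd] at h2
    linarith
  refine ⟨?_, fun j hj => ?_, fun j hj => ?_⟩
  · have h1 := (abs_le.1 (hT₀.trans hquad)).2
    have h2 := p.inner_g₀_qdir_le (dt := dt) hg0
    rw [← hq] at h2
    have h3 : ν₂ ≤ p.ρ * P.viol y ^ p.θ - inner ℝ (P.g₀ y) q := by
      have h5 : ν₂ ≤ p.θ * -inner ℝ (P.g₀ y) d₀ + (p.ρ - 1) * P.viol y ^ p.θ := by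
        have h7 : 0 ≤ (p.ρ - 1) * P.viol y ^ p.θ := by positivity
        have h8 : 0 ≤ p.θ * -inner ℝ (P.g₀ y) d₀ := mul_nonneg hθ.le (by linarith)
        rcases hcase with hc | hc
        · refine (min_le_left _ _).trans ?_
          have := mul_le_mul_of_nonneg_left (hsq hc) hθ.le
          linarith
        · refine (min_le_right _ _).trans ?_
          have h6 : (p.ρ - 1) * (κ / 2) ^ p.θ ≤ (p.ρ - 1) * P.viol y ^ p.θ :=
            mul_le_mul_of_nonneg_left (Real.rpow_le_rpow (by positivity) hc hθ.le) hρ1.le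
          linarith
      linarith
    have h4 : t * μ ≤ t * ((1 - p.γ) * (p.ρ * P.viol y ^ p.θ - inner ℝ (P.g₀ y) q)) :=
      mul_le_mul_of_nonneg_left ((min_le_right _ _).trans
        (mul_le_mul_of_nonneg_left h3 h1γ.le)) ht0.le
    linarith
  · have := hcon j
    rw [P.fbar_of_pos hj] at this
    linarith
  · have h1 := hcon j
    rw [P.fbar_of_nonpos hj] at h1
    have : 0 ≤ p.γ * t * β * (‖d₀‖ + P.viol y ^ p.σ) := by positivity
    linarith

end Params

/-! ### The Lagrangian and convergence of multipliers. -/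

namespace NCP
variable {n m : ℕ} {P : NCP n m}

lemma IsC2.contDiff_lagrangian (h : P.IsC2) (lam : Fin m → ℝ) :
    ContDiff ℝ 2 (P.lagrangian lam) := by
  have h1 := h.1
  have h2 := h.2
  unfold lagrangian
  exact h1.add (ContDiff.sum fun j _ => contDiff_const.mul (h2 j))

lemma IsC2.inner_gradient_lagrangian (h : P.IsC2) (lam : Fin m → ℝ) (x d : E n) :
    inner ℝ (gradient (P.lagrangian lam) x) d =
      inner ℝ (P.g₀ x) d + ∑ j, lam j * inner ℝ (P.g j x) d := by
  have h0 : HasFDerivAt P.f₀ (fderiv ℝ P.f₀ x) x :=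
    (h.1.differentiable (by norm_num) x).hasFDerivAt
  have hj : ∀ j, HasFDerivAt (P.f j) (fderiv ℝ (P.f j) x) x := fun j =>
    ((h.2 j).differentiable (by norm_num) x).hasFDerivAt
  have hL : HasFDerivAt (P.lagrangian lam)
      (fderiv ℝ P.f₀ x + ∑ j, lam j • fderiv ℝ (P.f j) x) x :=
    h0.add (HasFDerivAt.fun_sum fun j _ => (hj j).const_mul (lam j))
  rw [← fderiv_eq_inner_gradient, hL.fderiv, g₀, ← fderiv_eq_inner_gradient]
  simp [g]

/-- Along an ultrafilter on which the quadratic program solutions vanish, the multipliers converge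
to multipliers of the limit point. -/
lemma exists_tendsto_multiplier (h : P.IsC2) (hli : P.GradIndep) {ι : Type*} {U : Ultrafilter ι}
    {x d₀ : ι → E n} {B : ι → Matrix (Fin n) (Fin n) ℝ} {lam : ι → Fin m → ℝ} {xs : E n}
    {a b : ℝ} (ha : 0 < a) (hb : 0 < b) (hB : ∀ k, FormBounds a b (B k))
    (hqp : ∀ k, P.QPSolution (x k) (B k) (d₀ k) (lam k)) (hx : Tendsto x U (𝓝 xs))
    (hd : Tendsto d₀ U (𝓝 0)) (hv : P.viol xs = 0) :
    ∃ lams, Tendsto lam U (𝓝 lams) ∧ P.IsKKTPair xs lams := by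
  have hfs : ∀ j, P.f j xs ≤ 0 := P.viol_eq_zero_iff.1 hv
  have hvx : Tendsto (fun k => P.viol (x k)) U (𝓝 0) :=
    hv ▸ ((P.continuous_viol h.continuous_f).tendsto xs).comp hx
  have hg : ∀ j, Tendsto (fun k => P.g j (x k)) U (𝓝 (P.g j xs)) := fun j =>
    ((h.continuous_g j).tendsto xs).comp hx
  have hg0 : Tendsto (fun k => P.g₀ (x k)) U (𝓝 (P.g₀ xs)) := (h.continuous_g₀.tendsto xs).comp hx
  have hfb : ∀ j, Tendsto (fun k => P.fbar j (x k)) U (𝓝 (P.f j xs)) := fun j => by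
    have h1 : Tendsto (fun k => P.fbar j (x k) - P.f j (x k)) U (𝓝 0) :=
      squeeze_zero_norm (fun k => P.abs_fbar_sub_le j (x k)) hvx
    simpa using h1.add (((h.continuous_f j).tendsto xs).comp hx)
  have hlin : ∀ j, Tendsto (fun k => P.fbar j (x k) + inner ℝ (P.g j (x k)) (d₀ k)) U
      (𝓝 (P.f j xs)) := fun j => by
    simpa using (hfb j).add ((hg j).inner hd)
  have hBd : Tendsto (fun k => act (B k) (d₀ k)) U (𝓝 0) := by
    refine squeeze_zero_norm (fun k => norm_act_le (hB k).posDef ha hb (hB k).bounds (d₀ k)) ?_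
    simpa using hd.norm.const_mul b
  -- The linearisation of an inactive constraint stays negative, so complementarity kills its
  -- multiplier. Only independent gradients remain in the stationarity equation, which bounds λ^k
  -- and gives compactness.
  have hzero : ∀ᶠ k in U, ∀ j, ¬ P.fbar j xs = 0 → lam k j = 0 := by
    refine eventually_all.2 fun j => ?_
    by_cases hj : P.fbar j xs = 0
    · exact Eventually.of_forall fun k hne => absurd hj hne
    · rw [P.fbar_of_nonpos (hfs j)] at hj
      filter_upwards [(hlin j).eventually_lt_const (lt_of_le_of_ne (hfs j) hj)] with k hk _
      exact (mul_eq_zero.1 ((hqp k).compl j)).resolve_right hk.ne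
  obtain ⟨c, hc, hcy⟩ := exists_lower_bound_of_linearIndependent h.continuous_g
    (fun j => P.fbar j xs = 0) (hli xs)
  have hsum : Tendsto (fun k => ‖P.g₀ (x k) + act (B k) (d₀ k)‖) U (𝓝 ‖P.g₀ xs‖) := by
    simpa using (hg0.add hBd).norm
  have hbd : ∀ᶠ k in U, lam k ∈ Metric.closedBall (0 : Fin m → ℝ) ((‖P.g₀ xs‖ + 1) / c) := by
    filter_upwards [hx.eventually hcy, hzero,
      hsum.eventually_le_const (lt_add_one _)] with k h1 h2 h3
    rw [mem_closedBall_zero_iff, le_div_iff₀ hc, mul_comm]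
    refine (h1 (lam k) h2).trans ?_
    rwa [eq_neg_of_add_eq_zero_right (hqp k).stationary, norm_neg]
  obtain ⟨lams, -, hlams⟩ := (isCompact_closedBall (0 : Fin m → ℝ) _).ultrafilter_le_nhds'
    (U.map lam) hbd
  have hl : Tendsto lam U (𝓝 lams) := hlams
  have hlj : ∀ j, Tendsto (fun k => lam k j) U (𝓝 (lams j)) := tendsto_pi_nhds.1 hl
  refine ⟨lams, hl, ?_, hfs, fun j => ?_, fun j => ?_⟩
  · have h1 := (hg0.add hBd).add (tendsto_finsetSum Finset.univ fun j _ => (hlj j).smul (hg j))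
    rw [add_zero] at h1
    exact tendsto_nhds_unique h1 (tendsto_const_nhds.congr fun k => (hqp k).stationary.symm)
  · exact ge_of_tendsto' (hlj j) fun k => (hqp k).dual j
  · exact tendsto_nhds_unique ((hlj j).mul (hlin j))
      (tendsto_const_nhds.congr fun k => ((hqp k).compl j).symm)

end NCP

/-! ### The corrected direction and acceptance of the unit step. -/

namespace Params
variable {n m : ℕ} {P : NCP n m} (p : Params)

section correction
variable {x d₀ d₁ : E n} {B : Matrix (Fin n) (Fin n) ℝ} {lam w : Fin m → ℝ} {G M V : ℝ}

lemma rpow_τ_le_sq {s : ℝ} (h0 : 0 ≤ s) (h1 : s ≤ 1) : s ^ p.τ ≤ s ^ 2 := by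
  rw [← Real.rpow_two]
  exact Real.rpow_le_rpow_of_exponent_ge' h0 h1 (by norm_num) p.τ_mem.1.le

lemma norm_rhsCorr_le (hM : 0 ≤ M) (h1 : ‖d₀‖ ≤ 1)
    (hT : ∀ j, |P.f j (x + d₀) - P.f j x - inner ℝ (P.g j x) d₀| ≤ M * ‖d₀‖ ^ 2) :
    ‖p.rhsCorr P x d₀‖ ≤ (1 + M) * (‖d₀‖ ^ 2 + P.viol x ^ p.σ) := by
  have hv := Real.rpow_nonneg (P.viol_nonneg x) p.σ
  have ht := Real.rpow_nonneg (norm_nonneg d₀) p.τ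
  refine (pi_norm_le_iff_of_nonneg (by positivity)).2 fun j => ?_
  have h2 := p.rpow_τ_le_sq (norm_nonneg d₀) h1
  have h3 := abs_le.1 (hT j)
  have h4 : 0 ≤ M * P.viol x ^ p.σ := by positivity
  rw [rhsCorr, Real.norm_eq_abs, abs_le]
  constructor <;> linarith [h3.1, h3.2, sq_nonneg ‖d₀‖]

/-- A full step along the corrected direction reduces every constraint by
`‖d₀‖ ^ τ + φ ^ σ` up to higher-order terms. -/
lemma constraint_corrected_le (hqp : P.QPSolution x B d₀ lam)
    (hs : P.SolvesSLE x B d₀ (p.rhsCorr P x d₀) d₁ w) {j : Fin m} {e : ℝ}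
    (hg : ‖P.g j x‖ ≤ G) (hf : |P.fbar j x| ≤ G) (hw : |w j| ≤ V)
    (hT : |P.f j (x + (d₀ + d₁)) - P.f j (x + d₀) - inner ℝ (P.g j x) d₁| ≤ e)
    (hsm : V * (G + ‖d₀‖) ≤ 1) :
    P.f j (x + (d₀ + d₁)) ≤ P.f j x - P.fbar j x - (‖d₀‖ ^ p.τ + P.viol x ^ p.σ)
      + G * ‖d₀‖ ^ 2 * V + e := by
  have h1 := hs.2 j
  rw [rhsCorr] at h1
  have h2 := hqp.feasible j
  have hfb := P.fbar_nonpos j x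
  have h3 : inner ℝ (P.g j x) d₀ ≤ G * ‖d₀‖ :=
    (le_abs_self _).trans ((abs_real_inner_le_norm _ _).trans (by gcongr))
  have hV : 0 ≤ V := (abs_nonneg _).trans hw
  have hG : 0 ≤ G := (norm_nonneg _).trans hg
  set u := -(P.fbar j x + inner ℝ (P.g j x) d₀) with hu
  have hu0 : 0 ≤ u := by linarith
  -- Here u is the slack of the linearised constraint and |f̄_j| ≤ u + G‖d₀‖. The part of D_j h_j
  -- proportional to u is absorbed by that slack thanks to `hsm`; the rest is of order ‖d₀‖²V.
  have h4 : P.diag x d₀ j * w j ≤ u + G * ‖d₀‖ ^ 2 * V := by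
    have h5 : P.diag x d₀ j * w j ≤ P.diag x d₀ j * V :=
      mul_le_mul_of_nonneg_left ((le_abs_self _).trans hw) (P.diag_nonneg x d₀ j)
    have h6 : P.diag x d₀ j = |P.fbar j x| * (u + ‖d₀‖) := by
      rw [NCP.diag, abs_of_nonpos h2]
    have h7 : P.diag x d₀ j ≤ G * u + (u + G * ‖d₀‖) * ‖d₀‖ := by
      rw [h6, mul_add]
      refine add_le_add (mul_le_mul_of_nonneg_right hf hu0)
        (mul_le_mul_of_nonneg_right ?_ (norm_nonneg _))
      rw [abs_of_nonpos hfb]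
      linarith
    have h8 := mul_le_mul_of_nonneg_right h7 hV
    have h9 := mul_le_mul_of_nonneg_left hsm hu0
    linarith
  linarith [(abs_le.1 hT).2]

/-- The decrease of the objective along a full corrected step. -/
lemma objective_corrected_le {a b : ℝ} (ha : 0 < a) (hb : 0 < b) (hB : FormBounds a b B)
    (hqp : P.QPSolution x B d₀ lam)
    (hs : P.SolvesSLE x B d₀ (p.rhsCorr P x d₀) d₁ w) {e Λ : ℝ}
    (hg : ∀ j, ‖P.g j x‖ ≤ G) (hw : ∀ j, |w j| ≤ V) (hd₁ : ‖d₁‖ ≤ V) (hlam : ∀ j, lam j ≤ Λ)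
    (hG : 0 ≤ G)
    (hT : |P.f₀ (x + (d₀ + d₁)) - P.f₀ (x + d₀) - inner ℝ (P.g₀ x) d₁| ≤ e) :
    P.f₀ (x + (d₀ + d₁)) ≤ P.f₀ (x + d₀)
      + ∑ j, lam j * (P.f j (x + d₀) - P.f j x - inner ℝ (P.g j x) d₀)
      + b * ‖d₀‖ * V + m * (Λ * (‖d₀‖ ^ p.τ + P.viol x ^ p.σ + G * ‖d₀‖ ^ 2 * V)) + e := by
  have hV : 0 ≤ V := (norm_nonneg _).trans hd₁
  -- Pairing stationarity with d₁ trades g₀ᵀd₁ for the terms λ_j g_jᵀd₁, in which the system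
  -- reproduces the curvature of f_j along d₀. The curvature of the objective is thereby completed
  -- to that of the Lagrangian.
  have h1 : inner ℝ (P.g₀ x + act B d₀ + ∑ j, lam j • P.g j x) d₁ = 0 := by
    rw [hqp.stationary, inner_zero_left]
  rw [inner_add_left, inner_add_left, sum_inner] at h1
  have h2 : -inner ℝ (act B d₀) d₁ ≤ b * ‖d₀‖ * V := by
    refine (neg_le_abs _).trans ((abs_real_inner_le_norm _ _).trans ?_)
    have := norm_act_le hB.posDef ha hb hB.bounds d₀
    exact mul_le_mul this hd₁ (norm_nonneg _) (by positivity)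
  have h3 : ∀ j, -inner ℝ (lam j • P.g j x) d₁ ≤
      lam j * (P.f j (x + d₀) - P.f j x - inner ℝ (P.g j x) d₀)
      + Λ * (‖d₀‖ ^ p.τ + P.viol x ^ p.σ + G * ‖d₀‖ ^ 2 * V) := by
    intro j
    have hl := hqp.dual j
    have h4 := hs.2 j
    rw [rhsCorr] at h4
    have h5 : lam j * -(P.diag x d₀ j * w j) ≤ lam j * (G * ‖d₀‖ ^ 2 * V) := by
      -- A nonzero multiplier makes the linearised constraint tight, so |f̄_j| ≤ G‖d₀‖ and D_j is of
      -- order ‖d₀‖².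
      rcases mul_eq_zero.1 (hqp.compl j) with h6 | h6
      · rw [h6]; simp
      · refine mul_le_mul_of_nonneg_left ?_ hl
        have h7 : |P.fbar j x| ≤ G * ‖d₀‖ := by
          rw [eq_neg_of_add_eq_zero_left h6, abs_neg]
          exact (abs_real_inner_le_norm _ _).trans
            (mul_le_mul_of_nonneg_right (hg j) (norm_nonneg _))
        have h8 : P.diag x d₀ j ≤ G * ‖d₀‖ ^ 2 := by
          rw [NCP.diag, h6, abs_zero, zero_add]
          exact (mul_le_mul_of_nonneg_right h7 (norm_nonneg _)).trans (by rw [sq, mul_assoc])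
        rw [← mul_neg]
        refine (mul_le_mul_of_nonneg_left ((neg_le_abs _).trans (hw j))
          (P.diag_nonneg x d₀ j)).trans ?_
        exact mul_le_mul_of_nonneg_right h8 hV
    have h9 : lam j * (‖d₀‖ ^ p.τ + P.viol x ^ p.σ + G * ‖d₀‖ ^ 2 * V) ≤
        Λ * (‖d₀‖ ^ p.τ + P.viol x ^ p.σ + G * ‖d₀‖ ^ 2 * V) := by
      refine mul_le_mul_of_nonneg_right (hlam j) ?_
      have := Real.rpow_nonneg (P.viol_nonneg x) p.σ
      positivity
    have h10 : inner ℝ (P.g j x) d₁ = P.diag x d₀ j * w j +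
        (-(‖d₀‖ ^ p.τ + P.viol x ^ p.σ) -
          (P.f j (x + d₀) - P.f j x - inner ℝ (P.g j x) d₀)) := by linarith
    rw [real_inner_smul_left, h10]
    linarith
  have h4 := Finset.sum_le_sum fun j (_ : j ∈ Finset.univ) => h3 j
  rw [Finset.sum_add_distrib, Finset.sum_neg_distrib] at h4
  simp only [Finset.sum_const, Finset.card_univ, Fintype.card_fin, nsmul_eq_mul] at h4
  linarith [(abs_le.1 hT).2]

end correction

end Params

namespace Params
variable {n m : ℕ} {P : NCP n m} (p : Params)

/-- Write s = ‖d₀‖ and w = φ^σ; both directions have norm at most (1 + N)(s + w). Since δ > 2, the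
power (s + w)^δ is a small multiple of s² + w². The s² part is covered by the descent a s², and the
w² part by ξφ^ϱ because ϱ < σ. -/
lemma dirTest_of_small {x d₀ d₁ : E n} {a N : ℝ} (hN : 0 ≤ N)
    (hg : inner ℝ (P.g₀ x) d₀ ≤ -(a * ‖d₀‖ ^ 2)) (h0 : ‖d₀‖ ≤ 1) (hv1 : P.viol x ≤ 1)
    (hd₁ : ‖d₁‖ ≤ N * (‖d₀‖ ^ 2 + P.viol x ^ p.σ))
    (ha : p.ζ * (1 + N) ^ p.δ * 2 * (‖d₀‖ + P.viol x ^ p.σ) ^ (p.δ - 2) ≤ a)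
    (hξ : p.ζ * (1 + N) ^ p.δ * 2 * (‖d₀‖ + P.viol x ^ p.σ) ^ (p.δ - 2) ≤ p.ξ) :
    p.DirTest P x d₀ (d₀ + d₁) := by
  have hδ := p.δ_gt
  have hζ := p.ζ_pos
  have hv := P.viol_nonneg x
  have hw := Real.rpow_nonneg hv p.σ
  set s := ‖d₀‖ with hs
  have hs0 : 0 ≤ s := norm_nonneg d₀
  set w := P.viol x ^ p.σ with hwd
  have hN1 : 0 ≤ 1 + N := by linarith
  set κ := p.ζ * (1 + N) ^ p.δ * 2 * (s + w) ^ (p.δ - 2) with hκ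
  have hY : p.ζ * ((1 + N) * (s + w)) ^ p.δ ≤ κ * (s ^ 2 + w ^ 2) := by
    have e1 : (s + w) ^ p.δ = (s + w) ^ 2 * (s + w) ^ (p.δ - 2) := by
      rw [← Real.rpow_two, ← Real.rpow_add_of_nonneg (by positivity) (by norm_num) (by linarith)]
      congr 1; ring
    rw [Real.mul_rpow hN1 (by positivity), e1]
    have e2 : (s + w) ^ 2 ≤ 2 * (s ^ 2 + w ^ 2) := by nlinarith [sq_nonneg (s - w)]
    have e3 : 0 ≤ p.ζ * (1 + N) ^ p.δ * (s + w) ^ (p.δ - 2) := by positivity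
    have := mul_le_mul_of_nonneg_left e2 e3
    rw [hκ]
    linarith
  have hw2 : w ^ 2 ≤ P.viol x ^ p.ϱ := by
    have hϱ := p.ϱ_lt
    have e1 : w ≤ P.viol x ^ p.ϱ :=
      Real.rpow_le_rpow_of_exponent_ge' hv hv1 p.ϱ_pos.le hϱ.le
    have e2 : w ≤ 1 := Real.rpow_le_one hv hv1 (by linarith [p.ϱ_pos])
    nlinarith
  have hY2 : p.ζ * ((1 + N) * (s + w)) ^ p.δ ≤ a * s ^ 2 + p.ξ * P.viol x ^ p.ϱ := by
    have e1 : κ * s ^ 2 ≤ a * s ^ 2 := by gcongr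
    have e2 : κ * w ^ 2 ≤ p.ξ * P.viol x ^ p.ϱ :=
      mul_le_mul hξ hw2 (sq_nonneg _) p.ξ_pos.le
    linarith
  have hb : ∀ t, 0 ≤ t → t ≤ (1 + N) * (s + w) →
      p.ζ * t ^ p.δ ≤ a * s ^ 2 + p.ξ * P.viol x ^ p.ϱ := fun t ht0 ht => by
    refine (mul_le_mul_of_nonneg_left ?_ hζ.le).trans hY2
    exact Real.rpow_le_rpow ht0 ht (by linarith)
  have h1 := hb s hs0 (by nlinarith [mul_nonneg hN (add_nonneg hs0 hw)])
  have h2 := hb ‖d₀ + d₁‖ (norm_nonneg _) (by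
    refine (norm_add_le _ _).trans ?_
    have : N * s ^ 2 ≤ N * s := mul_le_mul_of_nonneg_left (by nlinarith) hN
    linarith)
  have h3 : p.ζ * min (-s ^ p.δ) (-‖d₀ + d₁‖ ^ p.δ) + p.ξ * P.viol x ^ p.ϱ ≥ -(a * s ^ 2) := by
    rcases min_choice (-s ^ p.δ) (-‖d₀ + d₁‖ ^ p.δ) with h | h <;> rw [h] <;> linarith
  exact hg.trans h3

set_option maxHeartbeats 1000000 in
/-- Near a KKT point with small subproblem solutions, the full corrected step is accepted. -/
lemma eventually_unit_step (h : P.IsC2) (hli : P.GradIndep) {ι : Type*} {l : Filter ι}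
    {x d₀ : ι → E n} {B : ι → Matrix (Fin n) (Fin n) ℝ} {lam : ι → Fin m → ℝ} {xs : E n}
    {lams : Fin m → ℝ} {a b : ℝ} (ha : 0 < a) (hb : 0 < b) (hB : ∀ k, FormBounds a b (B k))
    (hqp : ∀ k, P.QPSolution (x k) (B k) (d₀ k) (lam k)) (hx : Tendsto x l (𝓝 xs))
    (hd : Tendsto d₀ l (𝓝 0)) (hv : P.viol xs = 0) (hlam : Tendsto lam l (𝓝 lams))
    (hho : (fun k => P.hessL lams xs (d₀ k) - act (B k) (d₀ k)) =o[l] d₀) :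
    ∀ᶠ k in l, ∀ d₁ w, P.SolvesSLE (x k) (B k) (d₀ k) (p.rhsCorr P (x k) (d₀ k)) d₁ w →
      p.DirTest P (x k) (d₀ k) (d₀ k + d₁) ∧ p.Search₁ P (x k) (d₀ k) (d₀ k + d₁) 1 := by
  obtain ⟨hα, hα1⟩ := p.α_mem
  obtain ⟨hτ, hτ3⟩ := p.τ_mem
  have hθ := p.θ_pos
  have hθσ := p.θ_lt
  have hσ : 0 < p.σ := hθ.trans hθσ
  have hρ := p.ρ_gt
  have hδ := p.δ_gt
  obtain ⟨C, hC, hCy⟩ := NCP.exists_SLE_bound h hli xs ha hb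
  obtain ⟨G, hG, hGy⟩ := h.exists_local_bound xs
  obtain ⟨M, hM, r, hr, hTay⟩ := h.exists_first_order_bound xs
  -- The descent available beyond the test is (1/2 - α)a s² = 4e s². The Lagrangian expansion costs
  -- e s², the Hessian error e s²/2 and the higher-order terms 2e s².
  set e : ℝ := (1 / 2 - p.α) * a / 4 with he
  have he0 : 0 < e := by
    have : 0 < 1 / 2 - p.α := by linarith
    positivity
  obtain ⟨r₂, hr₂, hTay₂⟩ :=
    SubfeasibleSQP.exists_second_order_bound (h.contDiff_lagrangian lams) xs he0
  set N : ℝ := C * (1 + M) with hN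
  have hN0 : 0 < N := by positivity
  set Λ : ℝ := ‖lams‖ + 1 with hΛ
  set s : ι → ℝ := fun k => ‖d₀ k‖ with hs
  set v : ι → ℝ := fun k => P.viol (x k) with hvd
  have hs0 : ∀ k, 0 ≤ s k := fun k => norm_nonneg _
  have hv0 : ∀ k, 0 ≤ v k := fun k => P.viol_nonneg _
  have ts : Tendsto s l (𝓝 0) := by simpa using hd.norm
  have tv : Tendsto v l (𝓝 0) := hv ▸ ((P.continuous_viol h.continuous_f).tendsto xs).comp hx
  have trpow : ∀ {u : ι → ℝ} {c : ℝ}, 0 < c → Tendsto u l (𝓝 0) →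
      Tendsto (fun k => u k ^ c) l (𝓝 0) := fun {u c} hc hu => by
    simpa [Real.zero_rpow hc.ne'] using hu.rpow_const (Or.inr hc.le)
  have tw : Tendsto (fun k => v k ^ p.σ) l (𝓝 0) := trpow hσ tv
  have tW : Tendsto (fun k => s k ^ 2 + v k ^ p.σ) l (𝓝 0) := by
    simpa using (ts.pow 2).add tw
  have tp : Tendsto (fun k => s k ^ (3 - p.τ)) l (𝓝 0) := trpow (by linarith) ts
  have tq : Tendsto (fun k => s k ^ (p.τ - 2)) l (𝓝 0) := trpow (by linarith) ts
  have tσθ : Tendsto (fun k => v k ^ (p.σ - p.θ)) l (𝓝 0) := trpow (by linarith) tv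
  have tδ : Tendsto (fun k => p.ζ * (1 + N) ^ p.δ * 2 * (s k + v k ^ p.σ) ^ (p.δ - 2)) l
      (𝓝 0) := by
    simpa using (trpow (c := p.δ - 2) (by linarith)
      (by simpa using ts.add tw)).const_mul (p.ζ * (1 + N) ^ p.δ * 2)
  have tx : Tendsto (fun k => ‖x k - xs‖) l (𝓝 0) := tendsto_iff_norm_sub_tendsto_zero.1 hx
  have tl : Tendsto (fun k => ‖lam k - lams‖) l (𝓝 0) := tendsto_iff_norm_sub_tendsto_zero.1 hlam
  -- The vanishing quantities to follow are, in turn, the distance to x*, the smallness needed for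
  -- `hsm`, the relative error in the constraints, and the factors of s² (`t4` auxiliary, `t5`) and
  -- of φ^θ (`t6`) in the objective.
  have t1 : Tendsto (fun k => ‖x k - xs‖ + s k + N * (s k ^ 2 + v k ^ p.σ)) l (𝓝 0) := by
    simpa using (tx.add ts).add (tW.const_mul N)
  have t2 : Tendsto (fun k => N * (s k ^ 2 + v k ^ p.σ) * (G + s k)) l (𝓝 0) := by
    simpa using (tW.const_mul N).mul (ts.const_add G)
  have t3 : Tendsto (fun k => G * N * (s k ^ (3 - p.τ) + s k ^ 2) + M * N *
      ((2 + N) * s k ^ (3 - p.τ) + N * s k ^ 2 + 2 * s k + N * (s k ^ 2 + v k ^ p.σ))) l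
      (𝓝 0) := by
    simpa using ((tp.add (ts.pow 2)).const_mul (G * N)).add
      (((((tp.const_mul (2 + N)).add ((ts.pow 2).const_mul N)).add (ts.const_mul 2)).add
        (tW.const_mul N)).const_mul (M * N))
  have t4 : Tendsto (fun k => N * (b * s k + M * (2 * s k + N * (s k ^ 2 + v k ^ p.σ)))) l
      (𝓝 0) := by
    simpa using ((ts.const_mul b).add
      (((ts.const_mul 2).add (tW.const_mul N)).const_mul M)).const_mul N
  have t5 : Tendsto (fun k => m * (M * ‖lam k - lams‖) + m * (Λ * s k ^ (p.τ - 2)) +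
      m * (Λ * (G * N * (s k ^ 2 + v k ^ p.σ))) +
      N * (b * s k + M * (2 * s k + N * (s k ^ 2 + v k ^ p.σ)))) l (𝓝 0) := by
    simpa using ((((tl.const_mul M).const_mul (m : ℝ)).add
      ((tq.const_mul Λ).const_mul (m : ℝ))).add
      (((tW.const_mul (G * N)).const_mul Λ).const_mul (m : ℝ))).add t4
  have t6 : Tendsto (fun k => (m * Λ +
      N * (b * s k + M * (2 * s k + N * (s k ^ 2 + v k ^ p.σ)))) * v k ^ (p.σ - p.θ)) l
      (𝓝 0) := by
    simpa using (t4.const_add (m * Λ)).mul tσθ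
  filter_upwards [hx.eventually hCy, hx.eventually hGy, t1.eventually_lt_const (lt_min hr hr₂),
    ts.eventually_le_const one_pos, tv.eventually_le_const one_pos,
    t2.eventually_le_const one_pos,
    t3.eventually_le_const (show (0 : ℝ) < 1 - p.α by linarith),
    t5.eventually_le_const (show 0 < 2 * e by linarith),
    t6.eventually_le_const (show 0 < p.ρ * (1 - p.α) by
      have : 0 < 1 - p.α := by linarith
      positivity),
    tl.eventually_le_const one_pos, hho.def he0, tδ.eventually_le_const ha,
    tδ.eventually_le_const p.ξ_pos] with k hCk hGk hball hs1 hv1 hsm hcon hobj₁ hobj₂ hlk hhk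
    hδa hδξ d₁ w hsol
  clear t1 t2 t3 t4 t5 t6 tδ tσθ tq tp tW tw ts tv tx tl
  set σk := v k ^ p.σ with hσk
  set τk := s k ^ p.τ with hτk
  set W := s k ^ 2 + σk with hW
  have hσk0 : 0 ≤ σk := Real.rpow_nonneg (hv0 k) _
  have hτk0 : 0 ≤ τk := Real.rpow_nonneg (hs0 k) _
  have hW0 : 0 ≤ W := by positivity
  have hsk0 := hs0 k
  have hx1 : x k ∈ Metric.ball xs r := by
    rw [Metric.mem_ball, dist_eq_norm]
    have := hball.trans_le (min_le_left _ _)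
    have h2 : 0 ≤ N * W := by positivity
    linarith
  have hx2 : x k + d₀ k ∈ Metric.ball xs (min r r₂) := by
    rw [Metric.mem_ball, dist_eq_norm, add_sub_right_comm]
    have h2 : 0 ≤ N * W := by positivity
    exact (norm_add_le _ _).trans_lt (lt_of_le_of_lt (le_add_of_nonneg_right h2) hball)
  have hx2' := Metric.ball_subset_ball (x := xs) (min_le_left r r₂) hx2
  obtain ⟨hT₀, hTj⟩ := hTay (x k) hx1 _ hx2' (x k) hx1
  simp only [add_sub_cancel_left, sub_self, norm_zero, add_zero] at hT₀ hTj
  have hRj : ∀ j, |P.f j (x k + d₀ k) - P.f j (x k) - inner ℝ (P.g j (x k)) (d₀ k)| ≤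
      M * s k ^ 2 := fun j => (hTj j).trans_eq (by simp only [hs]; ring)
  have hr1 := p.norm_rhsCorr_le hM.le hs1 hRj
  obtain ⟨hd₁, hw⟩ := hCk (B k) (d₀ k) d₁ _ w (hB k) hsol
  have hCN : C * ‖p.rhsCorr P (x k) (d₀ k)‖ ≤ N * W := by
    rw [hN, mul_assoc]
    exact mul_le_mul_of_nonneg_left hr1 hC.le
  replace hd₁ := hd₁.trans hCN
  replace hw := hw.trans hCN
  have hx3 : x k + (d₀ k + d₁) ∈ Metric.ball xs r := by
    rw [Metric.mem_ball, dist_eq_norm, add_sub_right_comm, ← add_assoc]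
    refine (norm_add₃_le).trans_lt (lt_of_le_of_lt ?_ (hball.trans_le (min_le_left _ _)))
    exact add_le_add le_rfl hd₁
  obtain ⟨hS₀, hSj⟩ := hTay (x k) hx1 _ hx3 _ hx2'
  have e1 : x k + (d₀ k + d₁) - (x k + d₀ k) = d₁ := by abel
  rw [e1, add_sub_cancel_left, add_sub_cancel_left] at hS₀
  simp only [e1, add_sub_cancel_left] at hSj
  have hrem : M * (‖d₀ k + d₁‖ + ‖d₀ k‖) * ‖d₁‖ ≤ M * (2 * s k + N * W) * (N * W) := by
    have h2 : ‖d₀ k + d₁‖ ≤ s k + N * W := (norm_add_le _ _).trans (add_le_add le_rfl hd₁)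
    have h3 : ‖d₀ k‖ = s k := rfl
    refine mul_le_mul (mul_le_mul_of_nonneg_left (by linarith) hM.le) hd₁ (norm_nonneg _)
      (by positivity)
  -- This is where τ < 3 enters: cubic errors are negligible against the built-in decrease s^τ.
  have hcube : s k ^ 3 = s k ^ (3 - p.τ) * τk := by
    rw [hτk, ← Real.rpow_add_of_nonneg hsk0 (by linarith) (by linarith), sub_add_cancel]
    norm_cast
  have hp0 : 0 ≤ s k ^ (3 - p.τ) := Real.rpow_nonneg hsk0 _
  have hquart : s k ^ 4 ≤ s k ^ (3 - p.τ) * τk := by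
    rw [← hcube]
    exact pow_le_pow_of_le_one hsk0 hs1 (by norm_num)
  have hconstr : ∀ j, P.f j (x k + (d₀ k + d₁)) ≤
      P.f j (x k) - P.fbar j (x k) - p.α * (τk + σk) := by
    intro j
    have h2 := p.constraint_corrected_le (hqp k) hsol (hGk.2.2 j).1 (hGk.2.2 j).2
      ((norm_le_pi_norm w j).trans hw) ((hSj j).trans hrem) hsm
    set P3 := s k ^ (3 - p.τ) with hP3
    have h3 : s k ^ 2 * W ≤ (P3 + s k ^ 2) * (τk + σk) := by
      have h4 : 0 ≤ P3 * σk := by positivity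
      have h5 : 0 ≤ s k ^ 2 * τk := by positivity
      rw [hW]
      linarith
    have h4 : (2 * s k + N * W) * W ≤
        ((2 + N) * P3 + N * s k ^ 2 + 2 * s k + N * W) * (τk + σk) := by
      have h6 : (2 * s k + N * W) * W =
          2 * s k ^ 3 + N * s k ^ 4 + N * s k ^ 2 * σk + (2 * s k + N * W) * σk := by
        rw [hW]; ring
      have h7 := mul_le_mul_of_nonneg_left hquart hN0.le
      have h8 : 0 ≤ (2 + N) * P3 * σk := by positivity
      have h9 : 0 ≤ (N * s k ^ 2 + 2 * s k + N * W) * τk := by positivity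
      rw [h6, hcube]
      linarith
    have h5 : G * N * (s k ^ 2 * W) + M * N * ((2 * s k + N * W) * W) ≤
        (1 - p.α) * (τk + σk) := by
      have h6 := mul_le_mul_of_nonneg_left h3 (show 0 ≤ G * N by positivity)
      have h7 := mul_le_mul_of_nonneg_left h4 (show 0 ≤ M * N by positivity)
      have h8 := mul_le_mul_of_nonneg_right hcon (show 0 ≤ τk + σk by positivity)
      linarith
    have h6 : G * s k ^ 2 * (N * W) + M * (2 * s k + N * W) * (N * W) =
      G * N * (s k ^ 2 * W) + M * N * ((2 * s k + N * W) * W) := by ring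
    change P.f j (x k + (d₀ k + d₁)) ≤ P.f j (x k) - P.fbar j (x k) - (τk + σk) +
      G * s k ^ 2 * (N * W) + M * (2 * s k + N * W) * (N * W) at h2
    linarith
  refine ⟨p.dirTest_of_small hN0.le ((hqp k).inner_g₀_le_neg_sq (hB k)) hs1 hv1 hd₁ hδa hδξ,
    ?_, fun j hj => ?_, fun j hj => ?_⟩
  · have hΛk : ∀ j, lam k j ≤ Λ := fun j => by
      have h2 : lam k j - lams j ≤ 1 :=
        (le_abs_self _).trans ((norm_le_pi_norm (lam k - lams) j).trans hlk)
      have h3 : lams j ≤ ‖lams‖ := (le_abs_self _).trans (norm_le_pi_norm lams j)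
      linarith
    have h2 := p.objective_corrected_le ha hb (hB k) (hqp k) hsol (fun j => (hGk.2.2 j).1)
      (fun j => (norm_le_pi_norm w j).trans hw) hd₁ hΛk hG.le (hS₀.trans hrem)
    have h3 := (abs_le.1 (hTay₂ (x k) (by
      rw [Metric.mem_ball, dist_eq_norm]
      have := hball.trans_le (min_le_right _ _)
      have h2 : 0 ≤ N * W := by positivity
      linarith) (d₀ k) (Metric.ball_subset_ball (min_le_right _ _) hx2))).2
    rw [h.inner_gradient_lagrangian] at h3
    simp only [NCP.lagrangian] at h3
    have h4 : inner ℝ (d₀ k) (fderiv ℝ (gradient (P.lagrangian lams)) xs (d₀ k)) ≤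
        inner ℝ (d₀ k) (act (B k) (d₀ k)) + e * s k ^ 2 := by
      have h5 : inner ℝ (d₀ k) (P.hessL lams xs (d₀ k) - act (B k) (d₀ k)) ≤ e * s k ^ 2 := by
        refine (real_inner_le_norm _ _).trans ?_
        refine (mul_le_mul_of_nonneg_left hhk (norm_nonneg _)).trans_eq ?_
        simp only [hs]; ring
      rw [inner_sub_right] at h5
      change inner ℝ (d₀ k) (P.hessL lams xs (d₀ k)) ≤ _
      linarith
    -- Replacing λ^k by its limit costs only o(s²), since each curvature term is O(s²).
    have h5 : ∑ j, lam k j * (P.f j (x k + d₀ k) - P.f j (x k) - inner ℝ (P.g j (x k)) (d₀ k)) ≤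
        ∑ j, lams j * P.f j (x k + d₀ k) - ∑ j, lams j * P.f j (x k) -
          ∑ j, lams j * inner ℝ (P.g j (x k)) (d₀ k) + m * (‖lam k - lams‖ * (M * s k ^ 2)) := by
      rw [← Finset.sum_sub_distrib, ← Finset.sum_sub_distrib]
      have h6 : (m : ℝ) * (‖lam k - lams‖ * (M * s k ^ 2)) =
          ∑ _j : Fin m, ‖lam k - lams‖ * (M * s k ^ 2) := by simp
      rw [h6, ← Finset.sum_add_distrib]
      refine Finset.sum_le_sum fun j _ => ?_
      have h7 : (lam k j - lams j) *
          (P.f j (x k + d₀ k) - P.f j (x k) - inner ℝ (P.g j (x k)) (d₀ k)) ≤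
          ‖lam k - lams‖ * (M * s k ^ 2) := by
        refine (le_abs_self _).trans ?_
        rw [abs_mul]
        exact mul_le_mul (norm_le_pi_norm (lam k - lams) j) (hRj j) (abs_nonneg _)
          (norm_nonneg _)
      linarith
    -- In the objective the decrease terms are errors: τ > 2 makes s^τ negligible against s², and σ
    -- > θ makes φ^σ negligible against φ^θ.
    have h6 : τk = s k ^ (p.τ - 2) * s k ^ 2 := by
      rw [hτk, ← Real.rpow_two, ← Real.rpow_add_of_nonneg hsk0 (by linarith) (by norm_num),
        sub_add_cancel]
    have h7 : σk = v k ^ (p.σ - p.θ) * v k ^ p.θ := by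
      rw [hσk, ← Real.rpow_add_of_nonneg (hv0 k) (by linarith) hθ.le, sub_add_cancel]
    have h8 := (hqp k).inner_g₀_le
    have h9 := ((hB k).bounds (d₀ k)).1
    change P.f₀ (x k + (d₀ k + d₁)) ≤ P.f₀ (x k + d₀ k) + _ + b * s k * (N * W)
      + m * (Λ * (τk + σk + G * s k ^ 2 * (N * W))) + M * (2 * s k + N * W) * (N * W) at h2
    change a * s k ^ 2 ≤ _ at h9
    change _ ≤ e * s k ^ 2 at h3
    have h10 := mul_le_mul_of_nonneg_right hobj₁ (sq_nonneg (s k))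
    have h11 := mul_le_mul_of_nonneg_right hobj₂ (Real.rpow_nonneg (hv0 k) p.θ)
    rw [mul_assoc, ← h7] at h11
    have h12 : b * s k * (N * W) + m * (Λ * (τk + σk + G * s k ^ 2 * (N * W)))
        + M * (2 * s k + N * W) * (N * W) + m * (‖lam k - lams‖ * (M * s k ^ 2)) ≤
        2 * e * s k ^ 2 + p.ρ * (1 - p.α) * v k ^ p.θ := by
      have h13 : b * s k * (N * W) + M * (2 * s k + N * W) * (N * W) =
          N * (b * s k + M * (2 * s k + N * W)) * (s k ^ 2 + σk) := by rw [← hW]; ring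
      rw [h6]
      linarith
    have h13 : (1 - p.α) * inner ℝ (P.g₀ (x k)) (d₀ k) ≤
        (1 - p.α) * -inner ℝ (d₀ k) (act (B k) (d₀ k)) :=
      mul_le_mul_of_nonneg_left h8 (by linarith)
    have h14 : (1 / 2 - p.α) * (a * s k ^ 2) ≤
        (1 / 2 - p.α) * inner ℝ (d₀ k) (act (B k) (d₀ k)) :=
      mul_le_mul_of_nonneg_left h9 (by linarith)
    have h15 : (1 / 2 - p.α) * (a * s k ^ 2) = 4 * (e * s k ^ 2) := by rw [he]; ring
    have h16 : 0 ≤ e * s k ^ 2 := by positivity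
    rw [one_smul, mul_one, mul_one]
    change _ ≤ _ + p.ρ * (1 - p.α) * v k ^ p.θ
    linarith
  · have h2 := hconstr j
    rw [P.fbar_of_pos hj] at h2
    rw [one_smul, mul_one]
    change _ ≤ P.viol (x k) - p.α * (τk + σk)
    linarith
  · have h2 := hconstr j
    rw [P.fbar_of_nonpos hj] at h2
    rw [one_smul]
    have : 0 ≤ p.α * (τk + σk) := by positivity
    linarith

end Params

/-! ### Decrease of the violation and the final contradiction. -/

namespace Params
variable {n m : ℕ} {P : NCP n m} {p : Params}

lemma Search₁.viol_le {x d₀ d : E n} {t : ℝ} (h : p.Search₁ P x d₀ d t) :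
    P.viol (x + t • d) ≤ max 0 (P.viol x - p.α * t * (‖d₀‖ ^ p.τ + P.viol x ^ p.σ)) := by
  refine P.viol_le_iff.2 ⟨le_max_left _ _, fun j => ?_⟩
  rcases le_or_gt (P.f j x) 0 with hj | hj
  · exact (h.satisfied j hj).trans (le_max_left _ _)
  · exact (h.violated j hj).trans (le_max_right _ _)

lemma Search₂.viol_le {x d₀ q : E n} {β t : ℝ} (h : p.Search₂ P x d₀ q β t) :
    P.viol (x + t • q) ≤ max 0 (P.viol x - p.γ * t * β * (‖d₀‖ + P.viol x ^ p.σ)) := by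
  refine P.viol_le_iff.2 ⟨le_max_left _ _, fun j => ?_⟩
  rcases le_or_gt (P.f j x) 0 with hj | hj
  · exact (h.satisfied j hj).trans (le_max_left _ _)
  · exact (h.violated j hj).trans (le_max_right _ _)

/-- Feasibility is preserved by the iteration. -/
lemma Step.viol_eq_zero {x d₀ x' : E n} {B : Matrix (Fin n) (Fin n) ℝ}
    (h : p.Step P x B d₀ x') (hx : P.viol x = 0) : P.viol x' = 0 := by
  have hf := P.viol_eq_zero_iff.1 hx
  refine P.viol_eq_zero_iff.2 fun j => ?_
  obtain ⟨d₁, h₁, -, ⟨-, t, ⟨i, -, -, hs, -⟩, rfl⟩ |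
    ⟨-, dt, ht, -, t, ⟨i, -, hs, -⟩, rfl⟩⟩ := h
  · exact hs.satisfied j (hf j)
  · exact hs.satisfied j (hf j)

/-- The first alternative of an iteration reduces a violation that stays positive. -/
lemma Accept₁.viol_le {x d₀ d : E n} {t : ℝ} (h : p.Accept₁ P x d₀ d t)
    (hpos : 0 < P.viol (x + t • d)) :
    P.viol (x + t • d) ≤ P.viol x - p.α * p.ε * P.viol x ^ p.σ := by
  obtain ⟨i, -, hε, hs, -⟩ := h
  have h1 := (le_max_iff.1 hs.viol_le).resolve_left (not_le.2 hpos)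
  have hα := p.α_mem.1
  have hε0 := p.ε_mem.1
  have hv := Real.rpow_nonneg (P.viol_nonneg x) p.σ
  have hd := Real.rpow_nonneg (norm_nonneg d₀) p.τ
  have h2 : p.α * p.ε * P.viol x ^ p.σ ≤ p.α * t * (‖d₀‖ ^ p.τ + P.viol x ^ p.σ) := by
    have ht : 0 < t := hε0.trans_le hε
    gcongr
    linarith
  linarith

/-- The second alternative of an iteration reduces a violation that stays positive. -/
lemma Accept₂.viol_le {x d₀ q : E n} {β t : ℝ} (h : p.Accept₂ P x d₀ q β t)
    (hpos : 0 < P.viol (x + t • q)) :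
    P.viol (x + t • q) ≤ P.viol x - p.γ * t * (β * (‖d₀‖ + P.viol x ^ p.σ)) := by
  obtain ⟨i, -, hs, -⟩ := h
  have h1 := (le_max_iff.1 hs.viol_le).resolve_left (not_le.2 hpos)
  linarith

lemma Accept₂.pos {x d₀ q : E n} {β t : ℝ} (h : p.Accept₂ P x d₀ q β t) : 0 < t := by
  obtain ⟨i, rfl, -⟩ := h
  exact pow_pos p.η_mem.1 i

/-- Backtracking stops before the step falls far below a threshold of acceptance. -/
lemma Accept₂.min_le {x d₀ q : E n} {β t T : ℝ} (h : p.Accept₂ P x d₀ q β t)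
    (hT : ∀ t, 0 < t → t ≤ T → p.Search₂ P x d₀ q β t) : min 1 (p.η * T) ≤ t := by
  obtain ⟨i, rfl, -, hl⟩ := h
  have hη := p.η_mem.1
  rcases i with _ | i
  · exact (min_le_left _ _).trans (by simp)
  · refine (min_le_right _ _).trans ?_
    -- The preceding trial step was rejected, so it exceeds T; the accepted step is η times it.
    have h1 : T < p.η ^ i := by
      by_contra! hc
      exact hl i (Nat.lt_succ_self i) (hT _ (pow_pos hη i) hc)
    rw [pow_succ']
    exact mul_le_mul_of_nonneg_left h1.le hη.le

/-- A run cannot keep a positive constraint violation and have an accumulation point. -/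
lemma IsRun.exists_viol_eq_zero {x d₀ : ℕ → E n} {B : ℕ → Matrix (Fin n) (Fin n) ℝ}
    {lam : ℕ → Fin m → ℝ} (hrun : p.IsRun P x B d₀ lam) (hindep : P.GradIndep)
    (hB : UniformlyPosDef B) (hC2 : P.IsC2) {xs : E n} (hacc : MapClusterPt xs atTop x)
    (hhess : ∀ lams, P.IsKKTPair xs lams →
      (fun k => P.hessL lams xs (d₀ k) - act (B k) (d₀ k)) =o[atTop] d₀) :
    ∃ k, P.viol (x k) = 0 := by
  by_contra! hne
  have hpos : ∀ k, 0 < P.viol (x k) := fun k => (P.viol_nonneg _).lt_of_ne (hne k).symm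
  obtain ⟨a, b, ha, hb, hab⟩ := hB
  have hFB : ∀ k, FormBounds a b (B k) := fun k => ⟨hrun.posDef k, hab k⟩
  have hg0 : ∀ k, inner ℝ (P.g₀ (x k)) (d₀ k) ≤ 0 := fun k =>
    ((hrun.qp k).inner_g₀_le_neg_sq (hFB k)).trans (neg_nonpos.2 (by positivity))
  have hα := p.α_mem.1
  have hγ := p.γ_mem.1
  have hε := p.ε_mem.1
  have hη := p.η_mem.1
  have hσ : 0 < p.σ := p.θ_pos.trans p.θ_lt
  have hanti : Antitone fun k => P.viol (x k) := antitone_nat_of_succ_le fun k => by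
    obtain ⟨d₁, h₁, -, ⟨-, t, hacc₁, he⟩ | ⟨-, dt, ht, -, t, hacc₂, he⟩⟩ := hrun.step k
    · have h1 := hacc₁.viol_le (he ▸ hpos (k + 1))
      rw [← he] at h1
      have := Real.rpow_nonneg (P.viol_nonneg (x k)) p.σ
      have h2 : 0 ≤ p.α * p.ε * P.viol (x k) ^ p.σ := by positivity
      linarith
    · have h1 := hacc₂.viol_le (he ▸ hpos (k + 1))
      rw [← he] at h1
      have h3 := Real.rpow_nonneg (P.viol_nonneg (x k)) p.σ
      have h4 := p.beta_nonneg (dt := dt) (hg0 k)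
      have h5 := hacc₂.pos
      have h2 : 0 ≤ p.γ * t * (p.beta P (x k) (d₀ k) dt * (‖d₀ k‖ + P.viol (x k) ^ p.σ)) := by
        positivity
      linarith
  obtain ⟨U, hU, hxU⟩ := mapClusterPt_iff_ultrafilter.1 hacc
  have hlim := tendsto_atTop_ciInf hanti
    ⟨0, by rintro _ ⟨k, rfl⟩; exact P.viol_nonneg (x k)⟩
  have hdiff : Tendsto (fun k => P.viol (x k) - P.viol (x (k + 1))) U (𝓝 0) := by
    simpa using (hlim.sub (hlim.comp (tendsto_add_atTop_nat 1))).mono_left hU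
  have hvU : Tendsto (fun k => P.viol (x k)) U (𝓝 (P.viol xs)) :=
    ((P.continuous_viol hC2.continuous_f).tendsto xs).comp hxU
  -- An ultrafilter selects one alternative on a whole set of U, so no subsequence is needed.
  rcases Ultrafilter.eventually_or.1 (Eventually.of_forall
    (f := (U : Filter ℕ)) (p := fun k => (∃ d t, p.Accept₁ P (x k) (d₀ k) d t ∧
      x (k + 1) = x k + t • d) ∨ ∃ d₁ w dt ht t,
        P.SolvesSLE (x k) (B k) (d₀ k) (p.rhsCorr P (x k) (d₀ k)) d₁ w ∧
        ¬ (p.DirTest P (x k) (d₀ k) (d₀ k + d₁) ∧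
          ∃ t, p.Accept₁ P (x k) (d₀ k) (d₀ k + d₁) t) ∧
        P.SolvesSLE (x k) (B k) (d₀ k) (p.rhsTilde P (x k) (d₀ k)) dt ht ∧
        p.Accept₂ P (x k) (d₀ k) (p.qdir P (x k) (d₀ k) dt) (p.beta P (x k) (d₀ k) dt) t ∧
        x (k + 1) = x k + t • p.qdir P (x k) (d₀ k) dt) (fun k => by
    obtain ⟨d₁, h₁, hs, ⟨-, t, h1, h2⟩ | ⟨hn, dt, ht, h0, t, h1, h2⟩⟩ := hrun.step k
    · exact Or.inl ⟨_, t, h1, h2⟩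
    · exact Or.inr ⟨d₁, h₁, dt, ht, t, hs, hn, h0, h1, h2⟩)) with hA | hA
  · have hdec : ∀ᶠ k in (U : Filter ℕ),
        p.α * p.ε * P.viol (x k) ^ p.σ ≤ P.viol (x k) - P.viol (x (k + 1)) := by
      filter_upwards [hA] with k ⟨d, t, hk, he⟩
      have h1 := hk.viol_le (he ▸ hpos (k + 1))
      rw [← he] at h1
      linarith
    have h1 : p.α * p.ε * P.viol xs ^ p.σ ≤ 0 :=
      le_of_tendsto_of_tendsto ((hvU.rpow_const (Or.inr hσ.le)).const_mul _) hdiff hdec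
    have h2 : P.viol xs = 0 := by
      by_contra hc
      have : 0 < P.viol xs := (P.viol_nonneg xs).lt_of_ne (Ne.symm hc)
      have : 0 < p.α * p.ε * P.viol xs ^ p.σ := by positivity
      linarith
    rw [h2] at hvU
    -- Since φ = φ^(1-σ) φ^σ, eventually φ < αε φ^σ, so the decrement would exceed φ itself.
    have h3 : Tendsto (fun k => P.viol (x k) ^ (1 - p.σ)) U (𝓝 0) := by
      have h1σ : 0 < 1 - p.σ := by linarith [p.σ_lt]
      simpa [Real.zero_rpow h1σ.ne'] using hvU.rpow_const (Or.inr h1σ.le)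
    obtain ⟨k, hk, hk2⟩ :=
      (hdec.and (h3.eventually_lt_const (show 0 < p.α * p.ε by positivity))).exists
    have h4 : P.viol (x k) = P.viol (x k) ^ (1 - p.σ) * P.viol (x k) ^ p.σ := by
      rw [← Real.rpow_add (hpos k), sub_add_cancel, Real.rpow_one]
    have h5 := mul_lt_mul_of_pos_right hk2 (Real.rpow_pos_of_pos (hpos k) p.σ)
    linarith [hpos (k + 1)]
  · obtain ⟨G, -, hG⟩ := hC2.exists_local_bound xs
    obtain ⟨ds, -, hds⟩ := (isCompact_closedBall (0 : E n) (G / a)).ultrafilter_le_nhds'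
      (U.map d₀) (by
        change ∀ᶠ k in (U : Filter ℕ), d₀ k ∈ Metric.closedBall (0 : E n) (G / a)
        filter_upwards [hxU.eventually hG] with k hk
        rw [mem_closedBall_zero_iff]
        exact ((hrun.qp k).norm_le ha (hFB k)).trans (div_le_div_of_nonneg_right hk.1 ha.le))
    have hdU : Tendsto d₀ U (𝓝 ds) := hds
    by_cases hcase : ds = 0 ∧ P.viol xs = 0
    · obtain ⟨rfl, hv⟩ := hcase
      obtain ⟨lams, hlams, hKKT⟩ :=
        NCP.exists_tendsto_multiplier hC2 hindep ha hb hFB hrun.qp hxU hdU hv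
      have hunit := p.eventually_unit_step hC2 hindep ha hb hFB hrun.qp hxU hdU hv hlams
        ((hhess lams hKKT).mono hU)
      obtain ⟨k, ⟨d₁, w, dt, ht, t, hs, hn, -⟩, hk⟩ := (hA.and hunit).exists
      obtain ⟨h1, h2⟩ := hk d₁ w hs
      -- The unit step is the trial with exponent 0: no earlier trial has to fail, and ε < 1 admits
      -- it.
      exact hn ⟨h1, 1, 0, by simp, p.ε_mem.2.le, h2, fun l hl => absurd hl (Nat.not_lt_zero l)⟩
    · have hκ : 0 < ‖ds‖ + P.viol xs := by
        have h1 := norm_nonneg ds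
        have h2 := P.viol_nonneg xs
        by_contra! hc
        exact hcase ⟨norm_eq_zero.1 (by linarith), by linarith⟩
      -- Half of the limit of ‖d₀^k‖ + φ_k serves as κ, so the threshold is met on a set of U.
      obtain ⟨T, hT, ω, hω, hev⟩ := p.exists_search₂ hC2 hindep xs ha hb (half_pos hκ)
      have hstep : 0 < p.γ * min 1 (p.η * T) * ω := by positivity
      obtain ⟨k, ⟨d₁, w, dt, ht, t, -, -, hs, hacc₂, he⟩, hk, hk2, hk3⟩ :=
        (hA.and ((hxU.eventually hev).and
          (((hdU.norm.add hvU).eventually_const_le (half_lt_self hκ)).and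
            (hdiff.eventually_lt_const hstep)))).exists
      obtain ⟨h1, h2⟩ := hk (B k) (d₀ k) dt (lam k) ht (hFB k) (hrun.qp k) hs hk2
      have h3 := hacc₂.min_le h2
      have h4 := hacc₂.viol_le (he ▸ hpos (k + 1))
      rw [← he] at h4
      have ht0 := hacc₂.pos
      have h5 : p.γ * min 1 (p.η * T) * ω ≤
          p.γ * t * (p.beta P (x k) (d₀ k) dt * (‖d₀ k‖ + P.viol (x k) ^ p.σ)) := by
        gcongr
      linarith

end Params

end SubfeasibleSQP

open SubfeasibleSQP in
theorem theorem4 {n m : ℕ} (P : NCP n m) (p : Params)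
    (x : ℕ → E n) (B : ℕ → Matrix (Fin n) (Fin n) ℝ) (d₀ : ℕ → E n) (lam : ℕ → Fin m → ℝ)
    (hrun : p.IsRun P x B d₀ lam)
    (hindep : P.GradIndep)
    (hB : UniformlyPosDef B)
    (hC2 : P.IsC2)
    (hbdd : Bornology.IsBounded (Set.range x))
    (xs : E n) (hacc : MapClusterPt xs Filter.atTop x)
    (hssosc : ∀ lams, P.IsKKTPair xs lams → P.SSOSC xs lams)
    (hhess : ∀ lams, P.IsKKTPair xs lams →
      (fun k => P.hessL lams xs (d₀ k) - act (B k) (d₀ k)) =o[Filter.atTop] d₀) :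
    ∃ k₀ : ℕ, ∀ k ≥ k₀, P.viol (x (k + 1)) = 0 ∧ x (k + 1) ∈ P.feasible := by
  obtain ⟨k₀, hk₀⟩ := hrun.exists_viol_eq_zero hindep hB hC2 hacc hhess
  have hall : ∀ k ≥ k₀, P.viol (x k) = 0 := fun k hk =>
    Nat.le_induction hk₀ (fun k _ ih => (hrun.step k).viol_eq_zero ih) k hk
  exact ⟨k₀, fun k hk =>
    have h := hall (k + 1) (by omega)
    ⟨h, P.viol_eq_zero_iff.1 h⟩⟩
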